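/- **Model.** Let $N_c\ge 1$ and $0<R_1<\dots<R_{N_c}$. Work under the conditional law given that the target's $N_c$ nearest base stations (BSs) are at distances $\mathbf R=(R_1,\dots,R_{N_c})$; BS 1 is the sensing BS. The parameters are $\lambda_{BS},\theta_b,G_m,\lambda,C_L,C_N,m_L,m_N,\eta_b,P_s,\sigma_{mono},\sigma_{bi},K_B,T,W>0$, $P_c,\zeta_{SI}\ge0$, an integer $N_b\ge1$ with $N_b\theta_b\le 2\pi$, path-loss exponents $\alpha_L>0$, $\alpha_N>2$, and a threshold $\tau>0$. Put $$p_{LOS}(r)=e^{-\eta_b r},\qquad p_n=p_{LOS}(R_n)\tfrac{N_b\theta_b}{2\pi},\qquad \lambda_I=\lambda_{BS}N_b\big(\tfrac{\theta_b}{2\pi}\big)^2,\qquad \xi=2\pi\lambda_I .$$ The following are independent. * Exponential radar cross sections $\sigma_m$ (mean $\sigma_{mono}$) and $\sigma_{b,n}$ (mean $\sigma_{bi}$), and events $C_n$ with $\mathbb P(C_n)=p_n$, $2\le n\le N_c$. * An exclusion radius $R_{N_c+1}$ with density $$f_T(r)=\tfrac{2(\pi\lambda_{BS})^{N_c}}{(N_c-1)!}(r^2-R_1^2)^{N_c-1}\,r\,e^{-\pi\lambda_{BS}(r^2-R_1^2)}\quad\text{on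 } r\ge R_1 .$$ * An exclusion radius $R_I$ with density $f_I(r)=2\pi\lambda_{BS}\,r\,e^{-\pi\lambda_{BS}r^2}$ on $r>0$. * Planar Poisson processes $\Phi_T,\Phi_L,\Phi_N$ with intensities $\lambda_{BS}\,p_{LOS}(|x|)\tfrac{N_b\theta_b}{2\pi}$, $p_{LOS}(|x|)\lambda_I$ and $(1-p_{LOS}(|x|))\lambda_I$. Their points carry i.i.d. marks independent of the points: $\sigma_x$ exponential with mean $\sigma_{bi}$ for $\Phi_T$; Gamma gains $g_x$ of mean $1$ and shape $m_L$ for $\Phi_L$, and shape $m_N$ for $\Phi_N$. Define $$P_{tot}=\tfrac{P_sG_m^2\lambda^2}{(4\pi)^3R_1^{2\alpha_L}}\sigma_m+\sum_{n=2}^{N_c}\mathbf 1_{C_n}\tfrac{P_sG_m^2\lambda^2}{(4\pi)^3R_1^{\alpha_L}R_n^{\alpha_L}}\sigma_{b,n},$$ $$I_T=\tfrac{P_sG_m^2\lambda^2}{(4\pi)^3R_1^{\alpha_L}}\sum_{x\in\Phi_T,\,|x|\ge R_{N_c+1}}\sigma_x|x|^{-\alpha_L},$$ $$I_{LS}=P_cG_m^2C_L\sum_{x\in\Phi_L,\,|x|\ge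 R_I}g_x|x|^{-\alpha_L},\qquad I_{NS}=P_cG_m^2C_N\sum_{x\in\Phi_N,\,|x|\ge R_I}g_x|x|^{-\alpha_N},$$ $$I_{tot}=I_T+I_{LS}+I_{NS}+K_BTW+P_c\zeta_{SI},\qquad \mathrm{SINR}_S=P_{tot}/I_{tot},$$ $$k=\frac{\mathbb E[P_{tot}]^2}{\mathrm{Var}(P_{tot})},\quad\theta=\frac{\mathrm{Var}(P_{tot})}{\mathbb E[P_{tot}]},\quad\eta=\Gamma(1+k)^{-1/k},\quad s_z=\frac{z\eta\tau}{\theta},\quad A(x)=1-\big(1-e^{-\eta x/\theta}\big)^{k}.$$ Let $G$ be a Gamma variable with shape $k$ and scale $\theta$, independent of $I_{tot}$. **Theorem.** 1. The interference sums converge almost surely. $P_{tot}$ is square integrable with $$\mathbb E[P_{tot}]=\mu_{1}+\sum_{n=2}^{N_c}p_n\mu_n,\qquad \mathrm{Var}(P_{tot})=\mu_1^2+\sum_{n=2}^{N_c}p_n(2-p_n)\mu_n^2,$$ where $\mu_1=\frac{P_sG_m^2\lambda^2\sigma_{mono}}{(4\pi)^3R_1^{2\alpha_L}}$ and $\mu_n=\frac{P_sG_m^2\lambda^2\sigma_{bi}}{(4\pi)^3R_1^{\alpha_L}R_n^{\alpha_L}}$.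 Moreover $k,\theta>0$, and $G$ has the mean and the variance of $P_{tot}$. 2. For all $s\ge0$, $$\mathcal L_{I_T}(s):=\mathbb E[e^{-sI_T}]=\int_{R_1}^\infty\exp\Big(-\lambda_{BS}N_b\theta_b\int_{\rho}^\infty p_{LOS}(r)\Big(1-\Big(1+\tfrac{sP_sG_m^2\lambda^2\sigma_{bi}}{(4\pi)^3R_1^{\alpha_L}r^{\alpha_L}}\Big)^{-1}\Big)r\,dr\Big)f_T(\rho)\,d\rho,$$ $$\mathcal L_{I_{LS}}\mathcal L_{I_{NS}}(s):=\mathbb E[e^{-s(I_{LS}+I_{NS})}]=\int_0^\infty e^{-\xi[J_L(s,\rho)+J_N(s,\rho)]}f_I(\rho)\,d\rho,$$ where $$J_L(s,\rho)=\int_\rho^\infty p_{LOS}(r)\Big[1-\Big(1+\tfrac{sP_cG_m^2C_Lr^{-\alpha_L}}{m_L}\Big)^{-m_L}\Big]r\,dr,$$ $$J_N(s,\rho)=\int_\rho^\infty(1-p_{LOS}(r))\Big[1-\Big(1+\tfrac{sP_cG_m^2C_Nr^{-\alpha_N}}{m_N}\Big)^{-m_N}\Big]r\,dr .$$ For a fixed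 exclusion radius $\rho>0$ in place of $R_I$, the Laplace transforms at $s$ of the LoS and of the NLoS sum are $e^{-\xi J_L(s,\rho)}$ and $e^{-\xi J_N(s,\rho)}$. 3. With $F(x)=\mathbb P(P_{tot}>x)$, $$\mathbb P(\mathrm{SINR}_S>\tau)=\mathbb E[F(\tau I_{tot})],\qquad \mathbb P(G/I_{tot}>\tau)=\mathbb E\big[\mathbb P(G>x)\big|_{x=\tau I_{tot}}\big].$$ For all $x\ge0$, $\mathbb P(G>x)\le A(x)$ if $k\ge1$ and $\mathbb P(G>x)\ge A(x)$ if $k\le1$. Almost surely $A(\tau I_{tot})=\sum_{z\ge1}\binom kz(-1)^{z+1}e^{-s_zI_{tot}}$. 4. The series $$S=\sum_{z=1}^\infty\binom kz(-1)^{z+1}\,\mathcal L_{I_T}(s_z)\,\mathcal L_{I_{LS}}\mathcal L_{I_{NS}}(s_z)\,e^{-s_zK_BTW}\,e^{-s_zP_c\zeta_{SI}}$$ converges absolutely and $S=\mathbb E[A(\tau I_{tot})]$. 5. $S$ approximates the coverage in the following sense: $\mathbb P(G/I_{tot}>\tau)\le S$ if $k\ge1$, and $\mathbb P(G/I_{tot}>\tau)\ge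 S$ if $k\le1$; and if $|F(x)-\mathbb P(G>x)|\le\varepsilon_1$ and $|\mathbb P(G>x)-A(x)|\le\varepsilon_2$ for all $x>0$, then $|\mathbb P(\mathrm{SINR}_S>\tau)-S|\le\varepsilon_1+\varepsilon_2$. -/

import Mathlib

open MeasureTheory ProbabilityTheory Set
open scoped ENNReal NNReal

noncomputable section

namespace CoopSensing

/-- The plane in which the base stations (BSs) are located, with its Euclidean norm. -/
abbrev Plane : Type := EuclideanSpace ℝ (Fin 2)

/-- Deterministic parameters of the network. -/
structure Params where
  /-- density of the BSs -/
  lamBS : ℝ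
  /-- number of beams of a BS -/
  Nb : ℕ
  /-- 3-dB beamwidth -/
  thetaB : ℝ
  /-- maximal antenna gain -/
  Gm : ℝ
  /-- wavelength -/
  wl : ℝ
  /-- LoS path-loss exponent -/
  aL : ℝ
  /-- NLoS path-loss exponent -/
  aN : ℝ
  /-- LoS path-loss intercept -/
  CL : ℝ
  /-- NLoS path-loss intercept -/
  CN : ℝ
  /-- LoS Nakagami parameter -/
  mL : ℝ
  /-- NLoS Nakagami parameter -/
  mN : ℝ
  /-- blockage parameter -/
  etaB : ℝ
  /-- sensing power -/
  Ps : ℝ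
  /-- communication power -/
  Pc : ℝ
  /-- mean monostatic radar cross section -/
  rcsMono : ℝ
  /-- mean bistatic radar cross section -/
  rcsBi : ℝ
  /-- Boltzmann constant -/
  KB : ℝ
  /-- temperature -/
  T : ℝ
  /-- bandwidth -/
  W : ℝ
  /-- residual self-interference fraction -/
  zetaSI : ℝ

/-- The ranges of the parameters. -/
structure Params.Valid (p : Params) : Prop where
  lamBS_pos : 0 < p.lamBS
  Nb_pos : 1 ≤ p.Nb
  thetaB_pos : 0 < p.thetaB
  /-- the beams of a BS do not overlap -/
  beams_le : p.Nb * p.thetaB ≤ 2 * Real.pi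
  Gm_pos : 0 < p.Gm
  wl_pos : 0 < p.wl
  aL_pos : 0 < p.aL
  two_lt_aN : 2 < p.aN
  CL_pos : 0 < p.CL
  CN_pos : 0 < p.CN
  mL_pos : 0 < p.mL
  mN_pos : 0 < p.mN
  etaB_pos : 0 < p.etaB
  Ps_pos : 0 < p.Ps
  Pc_nonneg : 0 ≤ p.Pc
  rcsMono_pos : 0 < p.rcsMono
  rcsBi_pos : 0 < p.rcsBi
  KB_pos : 0 < p.KB
  T_pos : 0 < p.T
  W_pos : 0 < p.W
  zetaSI_nonneg : 0 ≤ p.zetaSI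

namespace Params

variable (p : Params)

/-- Probability that a link of length `r` is LoS. -/
def pLOS (r : ℝ) : ℝ := Real.exp (-(p.etaB * r))

/-- Probability that a BS at distance `r` has a LoS link to the target and illuminates it. -/
def pLit (r : ℝ) : ℝ := p.pLOS r * (p.Nb * p.thetaB / (2 * Real.pi))

/-- Density of the BSs one of whose beams is aligned with the sensing beam. -/
def lamI : ℝ :=
  p.lamBS * (p.Nb * p.thetaB / (2 * Real.pi)) * (p.thetaB / (2 * Real.pi))

/-- Monostatic echo power per unit radar cross section, for a target at distance `R₁`. -/
def echoMono (R₁ : ℝ) : ℝ :=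
  p.Ps * p.Gm ^ 2 * p.wl ^ 2 / ((4 * Real.pi) ^ 3 * R₁ ^ (2 * p.aL))

/-- Bistatic echo power per unit radar cross section, for BSs at distances `R₁` and `R`. -/
def echoBi (R₁ R : ℝ) : ℝ :=
  p.Ps * p.Gm ^ 2 * p.wl ^ 2 / ((4 * Real.pi) ^ 3 * R₁ ^ p.aL * R ^ p.aL)

/-- Mean monostatic echo power. -/
def muMono (R₁ : ℝ) : ℝ := p.echoMono R₁ * p.rcsMono

/-- Mean bistatic echo power. -/
def muBi (R₁ R : ℝ) : ℝ := p.echoBi R₁ R * p.rcsBi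

/-- Density of the radius `R_I` of the exclusion disk for co-channel interference. -/
def densRI (r : ℝ) : ℝ :=
  if 0 < r then 2 * Real.pi * p.lamBS * r * Real.exp (-(Real.pi * p.lamBS * r ^ 2)) else 0

/-- Density of the distance from the target to its `(N_c + 1)`-th nearest BS, where
`N_c = K + 1`, given that the nearest BS is at distance `R₁`. -/
def densRT (K : ℕ) (R₁ r : ℝ) : ℝ :=
  if R₁ ≤ r then
    2 * (Real.pi * p.lamBS) ^ (K + 1) / (K.factorial : ℝ) * (r ^ 2 - R₁ ^ 2) ^ K * r *
      Real.exp (-(Real.pi * p.lamBS * (r ^ 2 - R₁ ^ 2)))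
  else 0

/-- LoS exponent functional. -/
def JL (s R : ℝ) : ℝ :=
  ∫ r in Ioi R, p.pLOS r *
    (1 - (1 + s * p.Pc * p.Gm ^ 2 * p.CL * r ^ (-p.aL) / p.mL) ^ (-p.mL)) * r

/-- NLoS exponent functional. -/
def JN (s R : ℝ) : ℝ :=
  ∫ r in Ioi R, (1 - p.pLOS r) *
    (1 - (1 + s * p.Pc * p.Gm ^ 2 * p.CN * r ^ (-p.aN) / p.mN) ^ (-p.mN)) * r

/-- The constant `ξ = 2 π λ_BS N_b (θ_b / 2π)²`. -/
def xi : ℝ := 2 * Real.pi * p.lamBS * p.Nb * (p.thetaB / (2 * Real.pi)) ^ 2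

/-- Closed form of the Laplace transform of the aggregate co-channel interference, which the
product notation `𝓛_{I_LS}(s) 𝓛_{I_NS}(s)` stands for: the product of the two transforms given
`R_I`, averaged over `R_I`. -/
def ltDirect (s : ℝ) : ℝ :=
  ∫ R in Ioi (0 : ℝ), Real.exp (-(p.xi * (p.JL s R + p.JN s R))) * p.densRI R

/-- Closed form of the Laplace transform of the target-reflected interference. -/
def ltTarget (K : ℕ) (R₁ s : ℝ) : ℝ :=
  ∫ R in Ioi R₁,
    Real.exp (-(p.lamBS * p.Nb * p.thetaB *
      ∫ r in Ioi R, p.pLOS r * (1 - 1 / (1 + s * p.muBi R₁ r)) * r)) * p.densRT K R₁ R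

end Params

/-- The three processes of interferers: BSs outside the cluster that illuminate the target (their
positions are relative to the target), and the aligned LoS and NLoS interferers (their positions
are relative to the sensing BS). -/
inductive Kind where
  | target
  | los
  | nlos

/-- Intensity measure of each process of interferers. -/
def Params.intensity (p : Params) : Kind → Measure Plane
  | .target => volume.withDensity fun x =>
      ENNReal.ofReal (p.lamBS * p.pLOS ‖x‖ * (p.Nb * p.thetaB / (2 * Real.pi)))
  | .los => volume.withDensity fun x => ENNReal.ofReal (p.pLOS ‖x‖ * p.lamI)
  | .nlos => volume.withDensity fun x => ENNReal.ofReal ((1 - p.pLOS ‖x‖) * p.lamI)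

/-- Law of the random factor of each interferer: an exponential radar cross section, or a
unit-mean Gamma fading gain. -/
def Params.markLaw (p : Params) : Kind → Measure ℝ
  | .target => expMeasure (1 / p.rcsBi)
  | .los => gammaMeasure p.mL p.mL
  | .nlos => gammaMeasure p.mN p.mN

/-- Path-loss exponent for each process of interferers. -/
def Params.exponent (p : Params) : Kind → ℝ
  | .target => p.aL
  | .los => p.aL
  | .nlos => p.aN

/-- Constant factor of each interference term. -/
def Params.amplitude (p : Params) (R₁ : ℝ) : Kind → ℝ
  | .target => p.Ps * p.Gm ^ 2 * p.wl ^ 2 / ((4 * Real.pi) ^ 3 * R₁ ^ p.aL)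
  | .los => p.Pc * p.Gm ^ 2 * p.CL
  | .nlos => p.Pc * p.Gm ^ 2 * p.CN

/-- A random measure `N` is a Poisson point process with intensity measure `Λ`: the mass of a set
of finite intensity is Poisson distributed, and masses of disjoint sets are independent. -/
structure IsPoissonPP {Ω X : Type*} [MeasurableSpace Ω] [MeasurableSpace X]
    (N : Ω → Measure X) (Λ : Measure X) (P : Measure Ω) : Prop where
  measurable : Measurable N
  poisson : ∀ A : Set X, MeasurableSet A → Λ A ≠ ∞ →
    HasLaw (fun ω => N ω A) ((poissonMeasure (Λ A).toNNReal).map fun n : ℕ => (n : ℝ≥0∞)) P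
  indep : ∀ (n : ℕ) (A : Fin n → Set X), (∀ i, MeasurableSet (A i)) →
    Pairwise (fun i j => Disjoint (A i) (A j)) → iIndepFun (fun i ω => N ω (A i)) P

/-- The random objects of the model, for a cluster of `N_c = K + 1` BSs: the sensing BS and `K`
candidate cooperating BSs. -/
structure Network (K : ℕ) (Ω : Type*) where
  /-- monostatic radar cross section -/
  rcsMono : Ω → ℝ
  /-- bistatic radar cross sections of the candidate cooperating BSs -/
  rcsBi : Fin K → Ω → ℝ
  /-- the event that a candidate BS has a LoS link to the target and illuminates it -/
  lit : Fin K → Set Ω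
  /-- distance to the first BS outside the cluster (exclusion radius around the target) -/
  radT : Ω → ℝ
  /-- exclusion radius around the sensing BS -/
  radI : Ω → ℝ
  /-- (possibly infinite) number of points of each process of interferers -/
  count : Kind → Ω → ℕ∞
  /-- positions of the interferers, of which the first `count` ones are used -/
  pos : Kind → ℕ → Ω → Plane
  /-- random factor (radar cross section or fading gain) of each interferer -/
  mark : Kind → ℕ → Ω → ℝ

/-- Labels of the independent sources of randomness. -/
inductive Source (K : ℕ) where
  | mono
  | bi (n : Fin K)
  | lit (n : Fin K)
  | radT
  | radI
  | points (j : Kind)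
  | mark (j : Kind) (i : ℕ)

namespace Network

variable {K : ℕ} {Ω : Type*}

/-- The counting measure of a process of interferers. -/
def pointMeasure (M : Network K Ω) (j : Kind) (ω : Ω) : Measure Plane :=
  open Classical in
  Measure.sum fun i : ℕ => if (i : ℕ∞) < M.count j ω then Measure.dirac (M.pos j i ω) else 0

/-- The σ-algebra generated by a source of randomness. -/
def sigma (M : Network K Ω) : Source K → MeasurableSpace Ω
  | .mono => MeasurableSpace.comap M.rcsMono inferInstance
  | .bi n => MeasurableSpace.comap (M.rcsBi n) inferInstance
  | .lit n => MeasurableSpace.generateFrom {M.lit n}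
  | .radT => MeasurableSpace.comap M.radT inferInstance
  | .radI => MeasurableSpace.comap M.radI inferInstance
  | .points j => MeasurableSpace.comap (fun ω => (M.count j ω, fun i => M.pos j i ω)) inferInstance
  | .mark j i => MeasurableSpace.comap (M.mark j i) inferInstance

/-- `P` is the law of the network conditioned on the distances `R = (R 0, …, R K)` from the target
to its `K + 1` nearest BSs. -/
structure IsModel [MeasurableSpace Ω] (M : Network K Ω) (p : Params) (R : Fin (K + 1) → ℝ)
    (P : Measure Ω) : Prop where
  measurable_rcsMono : Measurable M.rcsMono
  measurable_rcsBi : ∀ n, Measurable (M.rcsBi n)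
  measurable_lit : ∀ n, MeasurableSet (M.lit n)
  measurable_radT : Measurable M.radT
  measurable_radI : Measurable M.radI
  measurable_count : ∀ j, Measurable (M.count j)
  measurable_pos : ∀ j i, Measurable (M.pos j i)
  measurable_mark : ∀ j i, Measurable (M.mark j i)
  law_rcsMono : HasLaw M.rcsMono (expMeasure (1 / p.rcsMono)) P
  law_rcsBi : ∀ n, HasLaw (M.rcsBi n) (expMeasure (1 / p.rcsBi)) P
  prob_lit : ∀ n, P.real (M.lit n) = p.pLit (R n.succ)
  law_radT : HasLaw M.radT
    (volume.withDensity fun r => ENNReal.ofReal (p.densRT K (R 0) r)) P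
  law_radI : HasLaw M.radI (volume.withDensity fun r => ENNReal.ofReal (p.densRI r)) P
  poisson : ∀ j, IsPoissonPP (M.pointMeasure j) (p.intensity j) P
  law_mark : ∀ j i, HasLaw (M.mark j i) (p.markLaw j) P
  indep : iIndep M.sigma P

/-- Total echo power received by the sensing BS. -/
def Ptot (M : Network K Ω) (p : Params) (R : Fin (K + 1) → ℝ) (ω : Ω) : ℝ :=
  p.echoMono (R 0) * M.rcsMono ω +
    ∑ n : Fin K, (M.lit n).indicator (fun ω => p.echoBi (R 0) (R n.succ) * M.rcsBi n ω) ω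

/-- Contribution of the `i`-th point to an interference sum over points at distance at least
`d`. -/
def interfTerm (M : Network K Ω) (p : Params) (j : Kind) (d : ℝ) (ω : Ω) (i : ℕ) : ℝ :=
  open Classical in
  if (i : ℕ∞) < M.count j ω ∧ d ≤ ‖M.pos j i ω‖ then
    M.mark j i ω * ‖M.pos j i ω‖ ^ (-p.exponent j) else 0

/-- Interference from the points at distance at least `d`. -/
def interf (M : Network K Ω) (p : Params) (R : Fin (K + 1) → ℝ) (j : Kind) (d : ℝ) (ω : Ω) : ℝ :=
  p.amplitude (R 0) j * ∑' i, M.interfTerm p j d ω i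

/-- The exclusion radius that applies to each process of interferers. -/
def radius (M : Network K Ω) : Kind → Ω → ℝ
  | .target => M.radT
  | .los => M.radI
  | .nlos => M.radI

/-- Target-reflected interference. -/
def IT (M : Network K Ω) (p : Params) (R : Fin (K + 1) → ℝ) (ω : Ω) : ℝ :=
  M.interf p R .target (M.radius .target ω) ω

/-- LoS co-channel interference. -/
def ILS (M : Network K Ω) (p : Params) (R : Fin (K + 1) → ℝ) (ω : Ω) : ℝ :=
  M.interf p R .los (M.radius .los ω) ω

/-- NLoS co-channel interference. -/
def INS (M : Network K Ω) (p : Params) (R : Fin (K + 1) → ℝ) (ω : Ω) : ℝ :=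
  M.interf p R .nlos (M.radius .nlos ω) ω

/-- Total interference plus noise plus residual self-interference. -/
def Itot (M : Network K Ω) (p : Params) (R : Fin (K + 1) → ℝ) (ω : Ω) : ℝ :=
  M.IT p R ω + M.ILS p R ω + M.INS p R ω + p.KB * p.T * p.W + p.Pc * p.zetaSI

/-- The sensing SINR. -/
def sinr (M : Network K Ω) (p : Params) (R : Fin (K + 1) → ℝ) (ω : Ω) : ℝ :=
  M.Ptot p R ω / M.Itot p R ω

variable [MeasurableSpace Ω]

/-- Conditional sensing coverage probability. -/
def coverage (M : Network K Ω) (p : Params) (R : Fin (K + 1) → ℝ) (P : Measure Ω) (τ : ℝ) : ℝ :=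
  P.real {ω | τ < M.sinr p R ω}

/-- Moment-matched shape parameter. -/
def kEff (M : Network K Ω) (p : Params) (R : Fin (K + 1) → ℝ) (P : Measure Ω) : ℝ :=
  (∫ ω, M.Ptot p R ω ∂P) ^ 2 / variance (M.Ptot p R) P

/-- Moment-matched scale parameter. -/
def thetaEff (M : Network K Ω) (p : Params) (R : Fin (K + 1) → ℝ) (P : Measure Ω) : ℝ :=
  variance (M.Ptot p R) P / ∫ ω, M.Ptot p R ω ∂P

/-- The Gamma law that replaces the law of `Ptot` (Mathlib's second parameter is the rate). -/
def gammaLaw (M : Network K Ω) (p : Params) (R : Fin (K + 1) → ℝ) (P : Measure Ω) : Measure ℝ :=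
  gammaMeasure (M.kEff p R P) (M.thetaEff p R P)⁻¹

/-- Coverage probability when `Ptot` is replaced by an independent variable with the law
`gammaLaw`. -/
def gammaCoverage (M : Network K Ω) (p : Params) (R : Fin (K + 1) → ℝ) (P : Measure Ω)
    (τ : ℝ) : ℝ :=
  ((M.gammaLaw p R P).prod P).real {q | τ < q.1 / M.Itot p R q.2}

/-- The constant `η = Γ(1 + k)^(-1/k)`. -/
def eta (M : Network K Ω) (p : Params) (R : Fin (K + 1) → ℝ) (P : Measure Ω) : ℝ :=
  Real.Gamma (1 + M.kEff p R P) ^ (-(1 / M.kEff p R P))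

/-- Alzer's closed-form bound `1 - (1 - exp (-η x / θ))^k` for the Gamma tail at `x`. -/
def alzer (M : Network K Ω) (p : Params) (R : Fin (K + 1) → ℝ) (P : Measure Ω) (x : ℝ) : ℝ :=
  1 - (1 - Real.exp (-(M.eta p R P * x / M.thetaEff p R P))) ^ M.kEff p R P

/-- The arguments `s_z = z η τ / θ_eff`. -/
def sArg (M : Network K Ω) (p : Params) (R : Fin (K + 1) → ℝ) (P : Measure Ω) (τ : ℝ)
    (z : ℕ+) : ℝ :=
  (z : ℝ) * M.eta p R P * τ / M.thetaEff p R P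

/-- The `z`-th term of the series that approximates the coverage. -/
def coverageTerm (M : Network K Ω) (p : Params) (R : Fin (K + 1) → ℝ) (P : Measure Ω) (τ : ℝ)
    (z : ℕ+) : ℝ :=
  Ring.choose (M.kEff p R P) (z : ℕ) * (-1) ^ ((z : ℕ) + 1) *
    p.ltTarget K (R 0) (M.sArg p R P τ z) * p.ltDirect (M.sArg p R P τ z) *
    Real.exp (-(M.sArg p R P τ z * (p.KB * p.T * p.W))) *
    Real.exp (-(M.sArg p R P τ z * (p.Pc * p.zetaSI)))

end Network

/-- Laplace transform of a random variable. -/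
def laplace {Ω : Type*} [MeasurableSpace Ω] (P : Measure Ω) (X : Ω → ℝ) (s : ℝ) : ℝ :=
  ∫ ω, Real.exp (-(s * X ω)) ∂P

end CoopSensing

/-!
Each interference sum is shot noise of a Poisson process with independent marks. Averaging over the
marks turns its Laplace transform into the Laplace functional `exp (-∫ (1 - ψ))` of the unmarked
process, where `ψ` is the conditional Laplace transform of a single contribution; in polar
coordinates and for Gamma marks this gives the integrals `J_L` and `J_N`. The exclusion radii are
independent of the points, so they are integrated out at the end.

Alzer's inequality compares the Gamma density with the density of the law whose distribution
function is `(1 - exp (-b x))^k`. With `b` chosen as in the theorem, the logarithm of the ratio of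
the densities, divided by `x`, is monotone, hence the densities cross only once, and two
distribution functions whose densities cross once are comparable. The binomial series expands
Alzer's expression into exponentials; since the interference never falls below the positive noise
power, the expansion at the noise power dominates it uniformly and it may be integrated termwise.
Each integrated term is a product of Laplace transforms. The coverage probabilities are averages of
tails by independence of echo and interference, so the comparisons of tails carry over to them.
-/

noncomputable section

namespace CoopSensing

/-! ### Gamma laws -/

section GammaLaw

variable {a r : ℝ}

theorem gammaPDFReal_of_pos {x : ℝ} (hx : 0 < x) :
    gammaPDFReal a r x = r ^ a / Real.Gamma a * x ^ (a - 1) * Real.exp (-(r * x)) :=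
  if_pos hx.le

theorem gammaMeasure_eq_withDensity_restrict (a r : ℝ) :
    gammaMeasure a r = (volume.restrict (Ioi 0)).withDensity (gammaPDF a r) := by
  rw [gammaMeasure, ← withDensity_indicator measurableSet_Ioi]
  refine withDensity_congr_ae ?_
  filter_upwards [Measure.ae_ne volume (0 : ℝ)] with x hx
  rcases lt_or_gt_of_ne hx with h | h
  · simp [gammaPDF_of_neg h, h.le.not_gt]
  · simp [h]

theorem measurable_gammaPDF (a r : ℝ) : Measurable (gammaPDF a r) :=
  (measurable_gammaPDFReal a r).ennreal_ofReal

theorem toReal_gammaPDF (ha : 0 < a) (hr : 0 < r) (x : ℝ) :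
    (gammaPDF a r x).toReal = gammaPDFReal a r x :=
  ENNReal.toReal_ofReal (gammaPDFReal_nonneg ha hr x)

theorem ae_gammaMeasure_pos (a r : ℝ) : ∀ᵐ x ∂gammaMeasure a r, 0 < x := by
  rw [gammaMeasure_eq_withDensity_restrict]
  exact (withDensity_absolutelyContinuous _ _).ae_le (ae_restrict_mem measurableSet_Ioi)

theorem integral_gammaMeasure (ha : 0 < a) (hr : 0 < r) (f : ℝ → ℝ) :
    ∫ x, f x ∂gammaMeasure a r = ∫ x in Ioi 0, gammaPDFReal a r x * f x := by
  rw [gammaMeasure_eq_withDensity_restrict, integral_withDensity_eq_integral_toReal_smul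
    (measurable_gammaPDF a r) (by simp [gammaPDF])]
  simp only [toReal_gammaPDF ha hr, smul_eq_mul]

theorem integrable_gammaMeasure_iff (ha : 0 < a) (hr : 0 < r) (f : ℝ → ℝ) :
    Integrable f (gammaMeasure a r) ↔
      IntegrableOn (fun x => gammaPDFReal a r x * f x) (Ioi 0) := by
  rw [gammaMeasure_eq_withDensity_restrict, integrable_withDensity_iff_integrable_smul'
    (measurable_gammaPDF a r) (by simp [gammaPDF])]
  simp only [toReal_gammaPDF ha hr, smul_eq_mul, IntegrableOn]

theorem integrableOn_rpow_mul_exp_neg_mul (ha : 0 < a) (hr : 0 < r) :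
    IntegrableOn (fun x : ℝ => x ^ (a - 1) * Real.exp (-(r * x))) (Ioi 0) := by
  refine Integrable.of_integral_ne_zero ?_
  rw [Real.integral_rpow_mul_exp_neg_mul_Ioi ha hr]
  have := Real.Gamma_pos_of_pos ha
  positivity

theorem integral_exp_neg_gammaMeasure (ha : 0 < a) (hr : 0 < r) {c : ℝ} (hc : 0 ≤ c) :
    ∫ x, Real.exp (-(c * x)) ∂gammaMeasure a r = (1 + c / r) ^ (-a) := by
  have := Real.Gamma_pos_of_pos ha
  have hcongr : EqOn (fun x => gammaPDFReal a r x * Real.exp (-(c * x)))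
      (fun x => r ^ a / Real.Gamma a * (x ^ (a - 1) * Real.exp (-((r + c) * x)))) (Ioi 0) := by
    intro x hx
    simp only [gammaPDFReal_of_pos hx]
    rw [mul_assoc (r ^ a / _ * _), ← Real.exp_add]
    ring_nf
  rw [integral_gammaMeasure ha hr, setIntegral_congr_fun measurableSet_Ioi hcongr,
    integral_const_mul, Real.integral_rpow_mul_exp_neg_mul_Ioi ha (by positivity),
    show 1 + c / r = (r + c) / r by field_simp, Real.rpow_neg (by positivity),
    Real.div_rpow (by positivity) hr.le, Real.div_rpow (by positivity) (by positivity),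
    Real.one_rpow]
  field_simp

theorem eqOn_gammaPDFReal_mul_rpow (q : ℝ) :
    EqOn (fun x => gammaPDFReal a r x * x ^ q)
      (fun x => r ^ a / Real.Gamma a * (x ^ (a + q - 1) * Real.exp (-(r * x)))) (Ioi 0) := by
  intro x hx
  simp only [gammaPDFReal_of_pos hx]
  rw [show a + q - 1 = (a - 1) + q by ring, Real.rpow_add hx]
  ring

theorem integrable_rpow_gammaMeasure (ha : 0 < a) (hr : 0 < r) {q : ℝ} (hq : 0 < a + q) :
    Integrable (fun x => x ^ q) (gammaMeasure a r) :=
  (integrable_gammaMeasure_iff ha hr _).2 <|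
    IntegrableOn.congr_fun ((integrableOn_rpow_mul_exp_neg_mul hq hr).const_mul _)
      (eqOn_gammaPDFReal_mul_rpow q).symm measurableSet_Ioi

theorem integral_rpow_gammaMeasure (ha : 0 < a) (hr : 0 < r) {q : ℝ} (hq : 0 < a + q) :
    ∫ x, x ^ q ∂gammaMeasure a r = Real.Gamma (a + q) / (Real.Gamma a * r ^ q) := by
  rw [integral_gammaMeasure ha hr, setIntegral_congr_fun measurableSet_Ioi
    (eqOn_gammaPDFReal_mul_rpow q), integral_const_mul,
    Real.integral_rpow_mul_exp_neg_mul_Ioi hq hr, Real.div_rpow zero_le_one hr.le,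
    Real.one_rpow, Real.rpow_add hr]
  field_simp

theorem integral_id_gammaMeasure (ha : 0 < a) (hr : 0 < r) :
    ∫ x, x ∂gammaMeasure a r = a / r := by
  have h := integral_rpow_gammaMeasure ha hr (q := 1) (by positivity)
  have := Real.Gamma_pos_of_pos ha
  simp only [Real.rpow_one] at h
  rw [h, Real.Gamma_add_one ha.ne']
  field_simp

theorem integral_sq_gammaMeasure (ha : 0 < a) (hr : 0 < r) :
    ∫ x, x ^ 2 ∂gammaMeasure a r = a * (a + 1) / r ^ 2 := by
  have h := integral_rpow_gammaMeasure ha hr (q := 2) (by positivity)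
  have := Real.Gamma_pos_of_pos ha
  simp only [Real.rpow_two] at h
  rw [h, show a + 2 = a + 1 + 1 by ring, Real.Gamma_add_one (by positivity),
    Real.Gamma_add_one ha.ne']
  field_simp

theorem memLp_id_gammaMeasure (ha : 0 < a) (hr : 0 < r) : MemLp id 2 (gammaMeasure a r) := by
  rw [memLp_two_iff_integrable_sq aestronglyMeasurable_id]
  simpa using integrable_rpow_gammaMeasure ha hr (q := 2) (by positivity)

theorem variance_id_gammaMeasure (ha : 0 < a) (hr : 0 < r) :
    variance id (gammaMeasure a r) = a / r ^ 2 := by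
  have := isProbabilityMeasure_gammaMeasure ha hr
  rw [variance_eq_sub (memLp_id_gammaMeasure ha hr)]
  simp only [Pi.pow_apply, id_eq]
  rw [integral_sq_gammaMeasure ha hr, integral_id_gammaMeasure ha hr]
  field_simp
  ring

theorem integrableOn_gammaPDFReal (ha : 0 < a) (hr : 0 < r) :
    IntegrableOn (gammaPDFReal a r) (Ioi 0) := by
  have := isProbabilityMeasure_gammaMeasure ha hr
  simpa using (integrable_gammaMeasure_iff ha hr _).1 (integrable_const 1)

theorem gammaMeasure_real_Ioi (ha : 0 < a) (hr : 0 < r) (x : ℝ) :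
    (gammaMeasure a r).real (Ioi x) = ∫ y in Ioi x, gammaPDFReal a r y := by
  rw [measureReal_def, gammaMeasure, withDensity_apply _ measurableSet_Ioi,
    integral_eq_lintegral_of_nonneg_ae (ae_of_all _ (gammaPDFReal_nonneg ha hr))
      (measurable_gammaPDFReal a r).aestronglyMeasurable]
  rfl

theorem integral_Ioi_zero_gammaPDFReal (ha : 0 < a) (hr : 0 < r) :
    ∫ y in Ioi 0, gammaPDFReal a r y = 1 := by
  have := isProbabilityMeasure_gammaMeasure ha hr
  simpa using (integral_gammaMeasure ha hr fun _ => (1 : ℝ)).symm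

end GammaLaw

/-! ### Alzer's inequality -/

section Alzer

theorem setIntegral_Ioi_le_of_crossing {f g : ℝ → ℝ} {a : ℝ} (hf : IntegrableOn f (Ioi a))
    (hg : IntegrableOn g (Ioi a)) (heq : ∫ x in Ioi a, f x = ∫ x in Ioi a, g x)
    (hcross : ∀ x, a < x → (∀ y, a < y → y ≤ x → g y ≤ f y) ∨ ∀ y, x < y → f y ≤ g y)
    {x : ℝ} (hx : a ≤ x) : ∫ y in Ioi x, f y ≤ ∫ y in Ioi x, g y := by
  rcases hx.eq_or_lt with rfl | hax
  · exact heq.le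
  have hI : Ioi x ⊆ Ioi a := Ioi_subset_Ioi hx
  have hJ : Ioc a x ⊆ Ioi a := Ioc_subset_Ioi_self
  rcases hcross x hax with hbelow | habove
  · have hsplit : ∀ u : ℝ → ℝ, IntegrableOn u (Ioi a) →
        ∫ y in Ioi a, u y = (∫ y in Ioc a x, u y) + ∫ y in Ioi x, u y := fun u hu => by
      rw [← Ioc_union_Ioi_eq_Ioi hx, setIntegral_union Ioc_disjoint_Ioi_same measurableSet_Ioi
        (hu.mono_set hJ) (hu.mono_set hI)]
    have hle : ∫ y in Ioc a x, g y ≤ ∫ y in Ioc a x, f y :=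
      setIntegral_mono_on (hg.mono_set hJ) (hf.mono_set hJ) measurableSet_Ioc
        fun y hy => hbelow y hy.1 hy.2
    linarith [hsplit f hf, hsplit g hg]
  · exact setIntegral_mono_on (hf.mono_set hI) (hg.mono_set hI) measurableSet_Ioi habove

theorem intervalIntegral_exp_neg_mul {u : ℝ} (hu : u ≠ 0) :
    ∫ t in (0 : ℝ)..1, Real.exp (-(u * t)) = (1 - Real.exp (-u)) / u := by
  have h := intervalIntegral.integral_comp_mul_left (fun t => Real.exp t) (a := 0) (b := 1)
    (c := -u) (neg_ne_zero.2 hu)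
  simp only [neg_mul, mul_zero, mul_one, integral_exp, Real.exp_zero, smul_eq_mul] at h
  rw [h]
  field_simp
  ring

theorem one_sub_exp_neg_div_pos {u : ℝ} (hu : 0 < u) : 0 < (1 - Real.exp (-u)) / u :=
  div_pos (by simpa using hu) hu

theorem one_sub_exp_neg_div_le_rpow {y x : ℝ} (hy : 0 < y) (hyx : y ≤ x) :
    (1 - Real.exp (-y)) / y ≤ ((1 - Real.exp (-x)) / x) ^ (y / x) := by
  have hx : 0 < x := hy.trans_le hyx
  rw [← intervalIntegral_exp_neg_mul hy.ne', ← intervalIntegral_exp_neg_mul hx.ne',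
    intervalIntegral.integral_of_le zero_le_one, intervalIntegral.integral_of_le zero_le_one]
  have hprob : IsProbabilityMeasure (volume.restrict (Ioc (0 : ℝ) 1)) := ⟨by simp⟩
  have hint : ∀ u : ℝ, Integrable (fun t : ℝ => Real.exp (-(u * t)))
      (volume.restrict (Ioc (0 : ℝ) 1)) := fun u =>
    (Continuous.integrableOn_Icc (by fun_prop)).mono_set Ioc_subset_Icc_self
  have hpow : ∀ t : ℝ, Real.exp (-(x * t)) ^ (y / x) = Real.exp (-(y * t)) := fun t => by
    rw [← Real.exp_mul]
    congr 1
    field_simp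
  have jensen := (Real.concaveOn_rpow (p := y / x) (by positivity)
    ((div_le_one hx).2 hyx)).le_map_integral (μ := volume.restrict (Ioc (0 : ℝ) 1))
    (f := fun t => Real.exp (-(x * t)))
    ((Real.continuous_rpow_const (by positivity)).continuousOn) isClosed_Ici
    (ae_of_all _ fun t => (Real.exp_pos _).le) (hint x)
    (by simpa only [Function.comp_def, hpow] using hint y)
  simpa only [hpow] using jensen

/-- The function `u ↦ u⁻¹ log ∫₀¹ exp (-u t) dt`, in closed form. It governs the ratio of the
Gamma density to Alzer's density. -/
def logMeanExpNeg (u : ℝ) : ℝ := Real.log ((1 - Real.exp (-u)) / u) / u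

theorem monotoneOn_logMeanExpNeg : MonotoneOn logMeanExpNeg (Ioi 0) := by
  intro y (hy : 0 < y) x (hx : 0 < x) hyx
  have h := Real.log_le_log (one_sub_exp_neg_div_pos hy) (one_sub_exp_neg_div_le_rpow hy hyx)
  rw [Real.log_rpow (one_sub_exp_neg_div_pos hx)] at h
  refine (div_le_iff₀ hy).2 (h.trans_eq ?_)
  rw [logMeanExpNeg]
  ring

theorem exp_mul_logMeanExpNeg {u : ℝ} (hu : 0 < u) (c : ℝ) :
    Real.exp (c * (u * logMeanExpNeg u)) = ((1 - Real.exp (-u)) / u) ^ c := by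
  rw [Real.rpow_def_of_pos (one_sub_exp_neg_div_pos hu), logMeanExpNeg]
  congr 1
  field_simp

variable {k b r x : ℝ}

/-- The density on `(0, ∞)` of the law with distribution function `(1 - exp (-b x))^k`. -/
def alzerDensity (k b x : ℝ) : ℝ :=
  k * b * Real.exp (-(b * x)) * (1 - Real.exp (-(b * x))) ^ (k - 1)

theorem one_sub_exp_neg_mul_pos (hb : 0 < b) (hx : 0 < x) : 0 < 1 - Real.exp (-(b * x)) := by
  simpa using mul_pos hb hx

theorem alzerDensity_pos (hk : 0 < k) (hb : 0 < b) (hx : 0 < x) : 0 < alzerDensity k b x := by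
  have := one_sub_exp_neg_mul_pos hb hx
  unfold alzerDensity
  positivity

theorem hasDerivAt_one_sub_exp_rpow (k : ℝ) (hb : 0 < b) (hx : 0 < x) :
    HasDerivAt (fun x => (1 - Real.exp (-(b * x))) ^ k) (alzerDensity k b x) x := by
  have h : HasDerivAt (fun x => 1 - Real.exp (-(b * x))) (b * Real.exp (-(b * x))) x :=
    (((hasDerivAt_const_mul b (x := x)).fun_neg.exp).const_sub 1).congr_deriv (by ring)
  refine (h.rpow_const (p := k) (Or.inl (one_sub_exp_neg_mul_pos hb hx).ne')).congr_deriv ?_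
  unfold alzerDensity
  ring

theorem continuous_one_sub_exp_rpow (hk : 0 ≤ k) (b : ℝ) :
    Continuous fun x : ℝ => (1 - Real.exp (-(b * x))) ^ k :=
  (Real.continuous_rpow_const hk).comp (by fun_prop)

theorem tendsto_one_sub_exp_rpow (k : ℝ) (hb : 0 < b) :
    Filter.Tendsto (fun x => (1 - Real.exp (-(b * x))) ^ k) Filter.atTop (nhds 1) := by
  have h : Filter.Tendsto (fun x => 1 - Real.exp (-(b * x))) Filter.atTop (nhds (1 - 0)) :=
    tendsto_const_nhds.sub (Real.tendsto_exp_neg_atTop_nhds_zero.comp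
      (Filter.tendsto_id.const_mul_atTop hb))
  simpa using h.rpow_const (p := k) (Or.inl (by norm_num))

theorem integrableOn_alzerDensity (hk : 0 < k) (hb : 0 < b) :
    IntegrableOn (alzerDensity k b) (Ioi 0) :=
  integrableOn_Ioi_deriv_of_nonneg (continuous_one_sub_exp_rpow hk.le b).continuousWithinAt
    (fun _ hx => hasDerivAt_one_sub_exp_rpow k hb hx)
    (fun _ hx => (alzerDensity_pos hk hb hx).le) (tendsto_one_sub_exp_rpow k hb)

theorem integral_Ioi_alzerDensity (hk : 0 < k) (hb : 0 < b) (hx : 0 ≤ x) :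
    ∫ y in Ioi x, alzerDensity k b y = 1 - (1 - Real.exp (-(b * x))) ^ k :=
  integral_Ioi_of_hasDerivAt_of_nonneg (continuous_one_sub_exp_rpow hk.le b).continuousWithinAt
    (fun _ hy => hasDerivAt_one_sub_exp_rpow k hb (hx.trans_lt hy))
    (fun _ hy => (alzerDensity_pos hk hb (hx.trans_lt hy)).le) (tendsto_one_sub_exp_rpow k hb)

/-- The exponential rate `Γ(1 + k)^(-1/k) r` in Alzer's bound for the Gamma law of shape `k` and
rate `r`. It makes the two densities agree to leading order at `0`. -/
def alzerRate (k r : ℝ) : ℝ := Real.Gamma (1 + k) ^ (-(1 / k)) * r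

theorem alzerRate_pos (hk : 0 < k) (hr : 0 < r) : 0 < alzerRate k r := by
  have : 0 < Real.Gamma (1 + k) := Real.Gamma_pos_of_pos (by positivity)
  unfold alzerRate
  positivity

theorem alzerRate_rpow (hk : 0 < k) (hr : 0 < r) :
    alzerRate k r ^ k = r ^ k / (k * Real.Gamma k) := by
  have hG : 0 < Real.Gamma (1 + k) := Real.Gamma_pos_of_pos (by positivity)
  rw [alzerRate, Real.mul_rpow (by positivity) hr.le, ← Real.rpow_mul hG.le,
    show -(1 / k) * k = -1 by field_simp, Real.rpow_neg_one, add_comm 1 k,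
    Real.Gamma_add_one hk.ne']
  ring

/-- The function `v` for which the Gamma density is `exp (x v(x))` times Alzer's density. -/
def alzerSlope (k r x : ℝ) : ℝ :=
  alzerRate k r - r - (k - 1) * alzerRate k r * logMeanExpNeg (alzerRate k r * x)

theorem gammaPDFReal_eq_alzerDensity_mul_exp (hk : 0 < k) (hr : 0 < r) (hx : 0 < x) :
    gammaPDFReal k r x =
      alzerDensity k (alzerRate k r) x * Real.exp (x * alzerSlope k r x) := by
  have := Real.Gamma_pos_of_pos hk
  have hb := alzerRate_pos hk hr
  have hbx := mul_pos hb hx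
  have hE := one_sub_exp_neg_mul_pos hb hx
  have hrk : r ^ k = k * Real.Gamma k * (alzerRate k r * alzerRate k r ^ (k - 1)) := by
    rw [mul_comm (alzerRate k r), ← Real.rpow_add_one hb.ne', sub_add_cancel,
      alzerRate_rpow hk hr]
    field_simp
  have hexp : Real.exp (x * alzerSlope k r x) =
      (Real.exp (-(alzerRate k r * x)))⁻¹ * Real.exp (-(r * x)) *
        ((1 - Real.exp (-(alzerRate k r * x))) / (alzerRate k r * x)) ^ (-(k - 1)) := by
    rw [← exp_mul_logMeanExpNeg hbx, ← Real.exp_neg, ← Real.exp_add, ← Real.exp_add, alzerSlope]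
    congr 1
    ring
  rw [gammaPDFReal_of_pos hx, hexp, alzerDensity, Real.rpow_neg (div_pos hE hbx).le,
    Real.div_rpow hE.le hbx.le, Real.mul_rpow hb.le hx.le, hrk]
  field_simp [(Real.rpow_pos_of_pos hE (k - 1)).ne', (Real.exp_pos (-(alzerRate k r * x))).ne']

theorem alzerDensity_le_gammaPDFReal (hk : 0 < k) (hr : 0 < r) (hx : 0 < x)
    (h : 0 ≤ alzerSlope k r x) : alzerDensity k (alzerRate k r) x ≤ gammaPDFReal k r x := by
  rw [gammaPDFReal_eq_alzerDensity_mul_exp hk hr hx]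
  exact le_mul_of_one_le_right (alzerDensity_pos hk (alzerRate_pos hk hr) hx).le
    (Real.one_le_exp (mul_nonneg hx.le h))

theorem gammaPDFReal_le_alzerDensity (hk : 0 < k) (hr : 0 < r) (hx : 0 < x)
    (h : alzerSlope k r x ≤ 0) : gammaPDFReal k r x ≤ alzerDensity k (alzerRate k r) x := by
  rw [gammaPDFReal_eq_alzerDensity_mul_exp hk hr hx]
  exact mul_le_of_le_one_right (alzerDensity_pos hk (alzerRate_pos hk hr) hx).le
    (Real.exp_le_one_iff.2 (mul_nonpos_of_nonneg_of_nonpos hx.le h))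

theorem monotoneOn_logMeanExpNeg_comp_mul (hb : 0 < b) :
    MonotoneOn (fun x => logMeanExpNeg (b * x)) (Ioi 0) := fun _ hy _ hz hyz =>
  monotoneOn_logMeanExpNeg (mul_pos hb hy) (mul_pos hb hz) (mul_le_mul_of_nonneg_left hyz hb.le)

theorem antitoneOn_alzerSlope (hk : 1 ≤ k) (hr : 0 < r) :
    AntitoneOn (alzerSlope k r) (Ioi 0) := fun _ hy _ hz hyz =>
  have hb := alzerRate_pos (zero_lt_one.trans_le hk) hr
  sub_le_sub_left (mul_le_mul_of_nonneg_left (monotoneOn_logMeanExpNeg_comp_mul hb hy hz hyz)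
    (mul_nonneg (sub_nonneg.2 hk) hb.le)) _

theorem monotoneOn_alzerSlope (hk : 0 < k) (hk1 : k ≤ 1) (hr : 0 < r) :
    MonotoneOn (alzerSlope k r) (Ioi 0) := fun _ hy _ hz hyz =>
  have hb := alzerRate_pos hk hr
  sub_le_sub_left (mul_le_mul_of_nonpos_left (monotoneOn_logMeanExpNeg_comp_mul hb hy hz hyz)
    (mul_nonpos_of_nonpos_of_nonneg (sub_nonpos.2 hk1) hb.le)) _

theorem integral_gammaPDFReal_eq_integral_alzerDensity (hk : 0 < k) (hr : 0 < r) :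
    ∫ y in Ioi 0, gammaPDFReal k r y = ∫ y in Ioi 0, alzerDensity k (alzerRate k r) y := by
  rw [integral_Ioi_zero_gammaPDFReal hk hr,
    integral_Ioi_alzerDensity hk (alzerRate_pos hk hr) le_rfl]
  simp [Real.zero_rpow hk.ne']

theorem gammaMeasure_real_Ioi_le_alzer (hk : 1 ≤ k) (hr : 0 < r) (hx : 0 ≤ x) :
    (gammaMeasure k r).real (Ioi x) ≤ 1 - (1 - Real.exp (-(alzerRate k r * x))) ^ k := by
  have hk0 : 0 < k := zero_lt_one.trans_le hk
  have hb := alzerRate_pos hk0 hr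
  rw [← integral_Ioi_alzerDensity hk0 hb hx, gammaMeasure_real_Ioi hk0 hr]
  refine setIntegral_Ioi_le_of_crossing (integrableOn_gammaPDFReal hk0 hr)
    (integrableOn_alzerDensity hk0 hb) (integral_gammaPDFReal_eq_integral_alzerDensity hk0 hr)
    (fun z hz => ?_) hx
  have hanti := antitoneOn_alzerSlope hk hr
  rcases le_total 0 (alzerSlope k r z) with h | h
  · exact Or.inl fun y hy hyz => alzerDensity_le_gammaPDFReal hk0 hr hy (h.trans (hanti hy hz hyz))
  · exact Or.inr fun y hzy => gammaPDFReal_le_alzerDensity hk0 hr (hz.trans hzy)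
      ((hanti hz (hz.trans hzy) hzy.le).trans h)

theorem alzer_le_gammaMeasure_real_Ioi (hk : 0 < k) (hk1 : k ≤ 1) (hr : 0 < r) (hx : 0 ≤ x) :
    1 - (1 - Real.exp (-(alzerRate k r * x))) ^ k ≤ (gammaMeasure k r).real (Ioi x) := by
  have hb := alzerRate_pos hk hr
  rw [← integral_Ioi_alzerDensity hk hb hx, gammaMeasure_real_Ioi hk hr]
  refine setIntegral_Ioi_le_of_crossing (integrableOn_alzerDensity hk hb)
    (integrableOn_gammaPDFReal hk hr) (integral_gammaPDFReal_eq_integral_alzerDensity hk hr).symm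
    (fun z hz => ?_) hx
  have hmono := monotoneOn_alzerSlope hk hk1 hr
  rcases le_total 0 (alzerSlope k r z) with h | h
  · exact Or.inr fun y hzy => alzerDensity_le_gammaPDFReal hk hr (hz.trans hzy)
      (h.trans (hmono hz (hz.trans hzy) hzy.le))
  · exact Or.inl fun y hy hyz => gammaPDFReal_le_alzerDensity hk hr hy ((hmono hy hz hyz).trans h)

end Alzer

/-! ### The binomial series -/

section Binomial

theorem hasSum_choose_mul_pow (k : ℝ) {q : ℝ} (hq : |q| < 1) :
    HasSum (fun n : ℕ => Ring.choose k n * q ^ n) ((1 + q) ^ k) := by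
  have h := (Real.one_add_rpow_hasFPowerSeriesOnBall_zero (a := k)).hasSum (y := q)
    (by simpa [enorm_eq_nnnorm, ← NNReal.coe_lt_coe] using hq)
  simpa [binomialSeries, FormalMultilinearSeries.coeff_ofScalars, mul_comm] using h

theorem hasSum_pnat_choose_mul_pow (k : ℝ) {q : ℝ} (hq : |q| < 1) :
    HasSum (fun z : ℕ+ => Ring.choose k (z : ℕ) * (-1) ^ ((z : ℕ) + 1) * q ^ (z : ℕ))
      (1 - (1 - q) ^ k) := by
  have h := (hasSum_choose_mul_pow k (q := -q) (by simpa using hq)).neg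
  rw [← hasSum_nat_add_iff' 1] at h
  have hsum : 1 - (1 - q) ^ k =
      -(1 + -q) ^ k - ∑ i ∈ Finset.range 1, -(Ring.choose k i * (-q) ^ i) := by
    simp only [Finset.range_one, Finset.sum_singleton, Ring.choose_zero_right, pow_zero]
    ring_nf
  rw [hsum, ← Equiv.pnatEquivNat.symm.hasSum_iff]
  refine h.congr_fun fun n => ?_
  change Ring.choose k (n + 1) * (-1) ^ (n + 1 + 1) * q ^ (n + 1) = _
  rw [neg_pow q]
  ring

end Binomial

/-! ### The exponential on `[0, ∞]` -/

section ExpNeg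

open Filter Topology

/-- The function `t ↦ e⁻ᵗ` on `[0, ∞]`, with `e^(-∞) = 0`. Laplace functionals are lower integrals
of it, so that no integrability or finiteness has to be assumed. -/
def expNeg (t : ℝ≥0∞) : ℝ≥0∞ := EReal.exp (-(t : EReal))

/-- The inverse `u ↦ -log u` of `expNeg` on `[0, 1]`, truncated to `0` for `u > 1`. -/
def negLog (u : ℝ≥0∞) : ℝ≥0∞ := (-ENNReal.log u).toENNReal

theorem expNeg_negLog {u : ℝ≥0∞} (hu : u ≤ 1) : expNeg (negLog u) = u := by
  have hlog : 0 ≤ -ENNReal.log u := by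
    rw [EReal.neg_nonneg]
    exact ENNReal.log_le_zero_iff.2 hu
  rw [expNeg, negLog, EReal.coe_toENNReal hlog, neg_neg, ENNReal.exp_log]

theorem expNeg_zero : expNeg 0 = 1 := by simp [expNeg]

theorem expNeg_add (s t : ℝ≥0∞) : expNeg (s + t) = expNeg s * expNeg t := by
  rw [expNeg, EReal.coe_ennreal_add, EReal.neg_add (.inl (by simp)) (.inr (by simp)),
    sub_eq_add_neg, EReal.exp_add]
  rfl

theorem expNeg_sum {ι : Type*} (s : Finset ι) (u : ι → ℝ≥0∞) :
    expNeg (∑ i ∈ s, u i) = ∏ i ∈ s, expNeg (u i) := by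
  induction s using Finset.cons_induction with
  | empty => exact expNeg_zero
  | cons i s hi ih => rw [Finset.sum_cons, Finset.prod_cons, expNeg_add, ih]

theorem expNeg_ofReal {x : ℝ} (hx : 0 ≤ x) :
    expNeg (ENNReal.ofReal x) = ENNReal.ofReal (Real.exp (-x)) := by
  rw [expNeg, EReal.coe_ennreal_ofReal, max_eq_left hx, ← EReal.coe_neg, EReal.exp_coe]

theorem expNeg_of_ne_top {t : ℝ≥0∞} (ht : t ≠ ∞) :
    expNeg t = ENNReal.ofReal (Real.exp (-t.toReal)) := by
  rw [← expNeg_ofReal ENNReal.toReal_nonneg, ENNReal.ofReal_toReal ht]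

theorem expNeg_mul_natCast (t : ℝ≥0∞) (n : ℕ) : expNeg (t * n) = expNeg t ^ n := by
  induction n with
  | zero => simp [expNeg_zero]
  | succ n ih => rw [Nat.cast_succ, mul_add_one, expNeg_add, ih, pow_succ]

theorem continuous_expNeg : Continuous expNeg :=
  ENNReal.continuous_exp.comp (continuous_neg.comp continuous_coe_ennreal_ereal)

theorem measurable_expNeg : Measurable expNeg := continuous_expNeg.measurable

theorem measurable_negLog : Measurable negLog := ENNReal.measurable_log.neg.ereal_toENNReal

theorem antitone_expNeg : Antitone expNeg := fun _ _ h =>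
  EReal.exp_monotone (EReal.neg_le_neg_iff.2 (EReal.coe_ennreal_le_coe_ennreal_iff.2 h))

theorem expNeg_le_one (t : ℝ≥0∞) : expNeg t ≤ 1 :=
  expNeg_zero ▸ antitone_expNeg (zero_le (a := t))

theorem one_sub_expNeg_le (t : ℝ≥0∞) : 1 - expNeg t ≤ t := by
  rcases eq_or_ne t ∞ with rfl | ht
  · exact le_top
  · rw [expNeg_of_ne_top ht, ← ENNReal.ofReal_one, ← ENNReal.ofReal_sub _ (Real.exp_pos _).le]
    exact ENNReal.ofReal_le_of_le_toReal (by linarith [Real.add_one_le_exp (-t.toReal)])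

theorem tendsto_lintegral_expNeg {Ω : Type*} [MeasurableSpace Ω] {P : Measure Ω}
    [IsFiniteMeasure P] {u : ℕ → Ω → ℝ≥0∞} {U : Ω → ℝ≥0∞} (hu : ∀ n, Measurable (u n))
    (hlim : ∀ ω, Tendsto (fun n => u n ω) atTop (𝓝 (U ω))) :
    Tendsto (fun n => ∫⁻ ω, expNeg (u n ω) ∂P) atTop (𝓝 (∫⁻ ω, expNeg (U ω) ∂P)) :=
  tendsto_lintegral_of_dominated_convergence (fun _ => 1)
    (fun n => measurable_expNeg.comp (hu n)) (fun n => ae_of_all _ fun _ => expNeg_le_one _)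
    (by simp) (ae_of_all _ fun ω => (continuous_expNeg.tendsto _).comp (hlim ω))

theorem lintegral_expNeg_le_one {E : Type*} [MeasurableSpace E] (μ : Measure E)
    [IsProbabilityMeasure μ] (f : E → ℝ≥0∞) : ∫⁻ x, expNeg (f x) ∂μ ≤ 1 :=
  (lintegral_mono fun _ => expNeg_le_one _).trans (by simp)

theorem one_sub_lintegral_expNeg_le {E : Type*} [MeasurableSpace E] (μ : Measure E)
    [IsProbabilityMeasure μ] {f : E → ℝ≥0∞} (hf : Measurable f) :
    1 - ∫⁻ x, expNeg (f x) ∂μ ≤ ∫⁻ x, f x ∂μ := by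
  rw [tsub_le_iff_right, ← lintegral_add_left hf]
  calc (1 : ℝ≥0∞) = ∫⁻ _, 1 ∂μ := by simp
    _ ≤ ∫⁻ x, f x + expNeg (f x) ∂μ :=
      lintegral_mono fun x => tsub_le_iff_right.1 (one_sub_expNeg_le (f x))

theorem lintegral_expNeg_tsum {Ω : Type*} [MeasurableSpace Ω] {P : Measure Ω}
    [IsProbabilityMeasure P] {Y : ℕ → Ω → ℝ≥0∞} (hY : ∀ i, Measurable (Y i))
    (hind : iIndepFun Y P) :
    ∫⁻ ω, expNeg (∑' i, Y i ω) ∂P = expNeg (∑' i, negLog (∫⁻ ω, expNeg (Y i ω) ∂P)) := by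
  have hpartial : ∀ n, ∫⁻ ω, expNeg (∑ i ∈ Finset.range n, Y i ω) ∂P =
      expNeg (∑ i ∈ Finset.range n, negLog (∫⁻ ω, expNeg (Y i ω) ∂P)) := fun n => by
    simp_rw [expNeg_sum, expNeg_negLog (lintegral_expNeg_le_one P _)]
    exact lintegral_prod_eq_prod_lintegral_of_indepFun _ _
      (hind.comp (fun _ => expNeg) fun _ => measurable_expNeg)
      fun i => measurable_expNeg.comp (hY i)
  refine tendsto_nhds_unique (tendsto_lintegral_expNeg
    (fun n => Finset.measurable_fun_sum _ fun i _ => hY i)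
    fun ω => ENNReal.summable.hasSum.tendsto_sum_nat) ?_
  simp_rw [hpartial]
  exact (continuous_expNeg.tendsto _).comp ENNReal.summable.hasSum.tendsto_sum_nat

end ExpNeg

/-! ### The Laplace functional of a Poisson process -/

section Poisson

open Filter Topology

theorem lintegral_poissonMeasure (r : ℝ≥0) (f : ℕ → ℝ≥0∞) :
    ∫⁻ n, f n ∂poissonMeasure r =
      ∑' n : ℕ, ENNReal.ofReal (Real.exp (-r) * r ^ n / n.factorial) * f n := by
  simp_rw [poissonMeasure, lintegral_sum_measure, lintegral_smul_measure, lintegral_dirac,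
    smul_eq_mul]

theorem lintegral_natCast_poissonMeasure (r : ℝ≥0) :
    ∫⁻ n : ℕ, (n : ℝ≥0∞) ∂poissonMeasure r = r := by
  have hsum : HasSum (fun n : ℕ => Real.exp (-r) * r ^ n / n.factorial * n) r := by
    rw [← hasSum_nat_add_iff' 1]
    have hshift := (hasSum_one_poissonMeasure r).mul_right (r : ℝ)
    simp only [Finset.range_one, Finset.sum_singleton, Nat.cast_zero, mul_zero, sub_zero]
    rw [one_mul] at hshift
    refine hshift.congr_fun fun n => ?_
    rw [Nat.factorial_succ]
    push_cast
    field_simp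
    ring
  rw [lintegral_poissonMeasure]
  simp_rw [fun n : ℕ => (ENNReal.ofReal_natCast n).symm,
    ← ENNReal.ofReal_mul (show 0 ≤ Real.exp (-r) * r ^ _ / (_ : ℕ).factorial by positivity)]
  rw [← ENNReal.ofReal_tsum_of_nonneg (fun n => by positivity) hsum.summable, hsum.tsum_eq,
    ENNReal.ofReal_coe_nnreal]

theorem lintegral_pow_poissonMeasure (r : ℝ≥0) {u : ℝ≥0∞} (hu : u ≤ 1) :
    ∫⁻ n : ℕ, u ^ n ∂poissonMeasure r = expNeg ((1 - u) * r) := by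
  lift u to ℝ≥0 using ne_top_of_le_ne_top ENNReal.one_ne_top hu
  have hu1 : (u : ℝ) ≤ 1 := by exact_mod_cast hu
  have hsum := (NormedSpace.expSeries_div_hasSum_exp ((r : ℝ) * u)).mul_left (Real.exp (-r))
  rw [← Real.exp_eq_exp_ℝ, ← Real.exp_add] at hsum
  have hterm : ∀ n : ℕ, ENNReal.ofReal (Real.exp (-r) * r ^ n / n.factorial) * (u : ℝ≥0∞) ^ n =
      ENNReal.ofReal (Real.exp (-r) * ((r * u) ^ n / n.factorial)) := fun n => by
    rw [← ENNReal.coe_pow, ← ENNReal.ofReal_coe_nnreal, ← ENNReal.ofReal_mul (by positivity)]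
    push_cast
    ring_nf
  have hexponent : (1 - (u : ℝ≥0∞)) * r = ENNReal.ofReal ((1 - u) * r) := by
    rw [ENNReal.ofReal_mul (by linarith), ENNReal.ofReal_sub _ u.coe_nonneg]
    simp
  rw [lintegral_poissonMeasure, hexponent, expNeg_ofReal (by nlinarith [r.coe_nonneg])]
  simp_rw [hterm]
  rw [← ENNReal.ofReal_tsum_of_nonneg (fun n => by positivity) hsum.summable, hsum.tsum_eq]
  ring_nf

open Classical in
theorem lintegral_comp_simpleFunc {X : Type*} [MeasurableSpace X] (ν : Measure X)
    (φ : SimpleFunc X ℝ≥0∞)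
    {g : ℝ≥0∞ → ℝ≥0∞} (hg : g 0 = 0) :
    ∫⁻ x, g (φ x) ∂ν = ∑ y : φ.range.erase 0, g y * ν (φ ⁻¹' {(y : ℝ≥0∞)}) := by
  have hmap : ∫⁻ x, g (φ x) ∂ν = (φ.map g).lintegral ν :=
    SimpleFunc.lintegral_eq_lintegral (φ.map g) ν
  rw [hmap, SimpleFunc.map_lintegral,
    Finset.sum_coe_sort (φ.range.erase 0) fun y => g y * ν (φ ⁻¹' {y}),
    Finset.sum_erase _ (by rw [hg, zero_mul])]

variable {Ω X : Type*} [MeasurableSpace Ω] [MeasurableSpace X] {N : Ω → Measure X}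
  {Λ : Measure X} {P : Measure Ω}

namespace IsPoissonPP

theorem measurable_apply (h : IsPoissonPP N Λ P) {A : Set X} (hA : MeasurableSet A) :
    Measurable fun ω => N ω A :=
  (Measure.measurable_coe hA).comp h.measurable

theorem measurable_lintegral (h : IsPoissonPP N Λ P) {f : X → ℝ≥0∞} (hf : Measurable f) :
    Measurable fun ω => ∫⁻ x, f x ∂N ω :=
  (Measure.measurable_lintegral hf).comp h.measurable

theorem lintegral_comp_apply (h : IsPoissonPP N Λ P) {A : Set X} (hA : MeasurableSet A)
    (hfin : Λ A ≠ ∞) {g : ℝ≥0∞ → ℝ≥0∞} (hg : Measurable g) :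
    ∫⁻ ω, g (N ω A) ∂P = ∫⁻ n : ℕ, g n ∂poissonMeasure (Λ A).toNNReal := by
  rw [← lintegral_map hg (h.measurable_apply hA), (h.poisson A hA hfin).map_eq,
    lintegral_map hg (by fun_prop)]

theorem lintegral_apply (h : IsPoissonPP N Λ P) {A : Set X} (hA : MeasurableSet A)
    (hfin : Λ A ≠ ∞) : ∫⁻ ω, N ω A ∂P = Λ A := by
  rw [h.lintegral_comp_apply hA hfin (g := fun t => t) measurable_id,
    lintegral_natCast_poissonMeasure, ENNReal.coe_toNNReal hfin]

theorem lintegral_expNeg_mul_apply (h : IsPoissonPP N Λ P) {A : Set X} (hA : MeasurableSet A)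
    (hfin : Λ A ≠ ∞) (y : ℝ≥0∞) :
    ∫⁻ ω, expNeg (y * N ω A) ∂P = expNeg ((1 - expNeg y) * Λ A) := by
  rw [h.lintegral_comp_apply hA hfin (g := fun t => expNeg (y * t))
    (measurable_expNeg.comp (measurable_const_mul y))]
  simp_rw [expNeg_mul_natCast]
  rw [lintegral_pow_poissonMeasure _ (expNeg_le_one y), ENNReal.coe_toNNReal hfin]

theorem bind_eq (h : IsPoissonPP N Λ P) [SigmaFinite Λ] : P.bind N = Λ := by
  refine (Measure.ext_iff_of_iUnion_eq_univ (iUnion_spanningSets Λ)).2 fun n => ?_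
  ext A hA
  have hm := hA.inter (measurableSet_spanningSets Λ n)
  rw [Measure.restrict_apply hA, Measure.restrict_apply hA,
    Measure.bind_apply hm h.measurable.aemeasurable]
  exact h.lintegral_apply hm
    ((measure_mono inter_subset_right).trans_lt (measure_spanningSets_lt_top Λ n)).ne

theorem lintegral_lintegral (h : IsPoissonPP N Λ P) [SigmaFinite Λ] {f : X → ℝ≥0∞}
    (hf : Measurable f) : ∫⁻ ω, ∫⁻ x, f x ∂N ω ∂P = ∫⁻ x, f x ∂Λ := by
  rw [← Measure.lintegral_bind h.measurable.aemeasurable hf.aemeasurable, h.bind_eq]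

theorem iIndepFun_apply (h : IsPoissonPP N Λ P) {ι : Type*} [Finite ι] {A : ι → Set X}
    (hA : ∀ i, MeasurableSet (A i)) (hdisj : Pairwise fun i j => Disjoint (A i) (A j)) :
    iIndepFun (fun i ω => N ω (A i)) P := by
  have hfin := h.indep (Nat.card ι) (fun i => A ((Finite.equivFin ι).symm i))
    (fun i => hA _) fun i j hij => hdisj ((Finite.equivFin ι).symm.injective.ne hij)
  simpa using hfin.precomp (Finite.equivFin ι).injective

theorem lintegral_expNeg_simpleFunc (h : IsPoissonPP N Λ P) (φ : SimpleFunc X ℝ≥0∞)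
    (hsupp : Λ (Function.support φ) ≠ ∞) :
    ∫⁻ ω, expNeg (∫⁻ x, φ x ∂N ω) ∂P = expNeg (∫⁻ x, (1 - expNeg (φ x)) ∂Λ) := by
  classical
  set s := φ.range.erase 0
  have hlevel : ∀ y : s, MeasurableSet (φ ⁻¹' {(y : ℝ≥0∞)}) := fun y => φ.measurableSet_fiber _
  have hfin : ∀ y : s, Λ (φ ⁻¹' {(y : ℝ≥0∞)}) ≠ ∞ := fun y =>
    measure_ne_top_of_subset (fun x (hx : φ x = y) => by
      rw [Function.mem_support, hx]
      exact Finset.ne_of_mem_erase y.2) hsupp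
  have hind : iIndepFun (fun (y : s) ω => N ω (φ ⁻¹' {(y : ℝ≥0∞)})) P :=
    h.iIndepFun_apply hlevel fun y z hyz => Disjoint.preimage _
      (disjoint_singleton.2 (Subtype.coe_injective.ne hyz))
  simp_rw [fun ω => lintegral_comp_simpleFunc (N ω) φ (g := fun t => t) rfl, expNeg_sum]
  rw [lintegral_comp_simpleFunc Λ φ (g := fun t => 1 - expNeg t) (by simp [expNeg_zero]),
    expNeg_sum, lintegral_prod_eq_prod_lintegral_of_indepFun Finset.univ
      (fun (y : s) ω => expNeg (y * N ω (φ ⁻¹' {(y : ℝ≥0∞)})))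
      (hind.comp (fun y t => expNeg (y * t)) fun y =>
        measurable_expNeg.comp (measurable_const_mul _))
      fun y => measurable_expNeg.comp ((h.measurable_apply (hlevel y)).const_mul _)]
  exact Finset.prod_congr rfl fun y _ => h.lintegral_expNeg_mul_apply (hlevel y) (hfin y) y

theorem lintegral_expNeg_lintegral (h : IsPoissonPP N Λ P) [SigmaFinite Λ]
    [IsProbabilityMeasure P] {v : X → ℝ≥0∞} (hv : Measurable v) :
    ∫⁻ ω, expNeg (∫⁻ x, v x ∂N ω) ∂P = expNeg (∫⁻ x, (1 - expNeg (v x)) ∂Λ) := by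
  set φ : ℕ → SimpleFunc X ℝ≥0∞ := fun n => (SimpleFunc.eapprox v n).restrict (spanningSets Λ n)
  have hφ : ∀ n x, φ n x = (spanningSets Λ n).indicator (SimpleFunc.eapprox v n) x := fun n x => by
    rw [SimpleFunc.restrict_apply _ (measurableSet_spanningSets Λ n)]
  have hmono : ∀ x, Monotone fun n => φ n x := fun x m n hmn => by
    simp only [hφ]
    exact (indicator_le_indicator_of_subset (monotone_spanningSets Λ hmn)
      (fun _ => zero_le) x).trans
      (indicator_le_indicator (SimpleFunc.monotone_eapprox v hmn x))
  have hlim : ∀ x, Tendsto (fun n => φ n x) atTop (𝓝 (v x)) := fun x => by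
    refine (SimpleFunc.tendsto_eapprox hv x).congr' ?_
    filter_upwards [eventually_ge_atTop (spanningSetsIndex Λ x)] with n hn
    rw [hφ, indicator_of_mem (monotone_spanningSets Λ hn (mem_spanningSetsIndex Λ x))]
  have hsupp : ∀ n, Λ (Function.support (φ n)) ≠ ∞ := fun n =>
    measure_ne_top_of_subset (fun x hx => by
      rw [Function.mem_support, hφ] at hx
      exact mem_of_indicator_ne_zero hx) (measure_spanningSets_lt_top Λ n).ne
  refine tendsto_nhds_unique (tendsto_lintegral_expNeg
    (fun n => h.measurable_lintegral (φ n).measurable)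
    fun ω => lintegral_tendsto_of_tendsto_of_monotone (fun n => (φ n).measurable.aemeasurable)
      (ae_of_all _ hmono) (ae_of_all _ hlim)) ?_
  simp_rw [fun n => h.lintegral_expNeg_simpleFunc (φ n) (hsupp n)]
  refine (continuous_expNeg.tendsto _).comp (lintegral_tendsto_of_tendsto_of_monotone
    (fun n => (measurable_const.sub (measurable_expNeg.comp (φ n).measurable)).aemeasurable)
    (ae_of_all _ fun x m n hmn => tsub_le_tsub_left (antitone_expNeg (hmono x hmn)) 1)
    (ae_of_all _ fun x => ?_))
  exact ENNReal.Tendsto.sub tendsto_const_nhds ((continuous_expNeg.tendsto _).comp (hlim x))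
    (.inl ENNReal.one_ne_top)

end IsPoissonPP

end Poisson

/-! ### Independently marked Poisson processes -/

section Marked

theorem lintegral_comp_prodMk_of_indepFun {Ω E F : Type*} [MeasurableSpace Ω] [MeasurableSpace E]
    [MeasurableSpace F] {P : Measure Ω} [IsFiniteMeasure P] {X : Ω → E} {Y : Ω → F}
    (h : IndepFun X Y P) (hX : Measurable X) (hY : Measurable Y) {g : E → F → ℝ≥0∞}
    (hg : Measurable (Function.uncurry g)) :
    ∫⁻ ω, g (X ω) (Y ω) ∂P = ∫⁻ ω, ∫⁻ ω', g (X ω) (Y ω') ∂P ∂P := by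
  have hprod : ∫⁻ ω, g (X ω) (Y ω) ∂P =
      ∫⁻ q, Function.uncurry g q ∂(P.map X).prod (P.map Y) := by
    rw [← h.map_prod_eq_prod_map_map hX.aemeasurable hY.aemeasurable,
      lintegral_map hg (hX.prodMk hY)]
    rfl
  rw [hprod, lintegral_prod _ hg.aemeasurable, lintegral_map hg.lintegral_prod_right' hX]
  exact lintegral_congr fun ω => lintegral_map (hg.comp measurable_prodMk_left) hY

variable {Ω X E : Type*}

/-- The shot noise `∑ f(x, m)` over the enumerated points `x` with their marks `m`. -/
def shotNoise (f : X → E → ℝ≥0∞) (a : ℕ∞ × (ℕ → X)) (m : ℕ → E) : ℝ≥0∞ :=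
  open Classical in ∑' i : ℕ, if (i : ℕ∞) < a.1 then f (a.2 i) (m i) else 0

theorem shotNoise_const_mul (c : ℝ≥0∞) (f : X → E → ℝ≥0∞) (a : ℕ∞ × (ℕ → X)) (m : ℕ → E) :
    shotNoise (fun x m => c * f x m) a m = c * shotNoise f a m := by
  simp_rw [shotNoise, ← ENNReal.tsum_mul_left, mul_ite, mul_zero]

variable [MeasurableSpace Ω] [MeasurableSpace X] [MeasurableSpace E]

/-- The counting measure of the points `x 0, x 1, …`, of which only the first `a.1` are used, in
an enumeration `a = (a.1, x)`. -/
def countingMeasure (a : ℕ∞ × (ℕ → X)) : Measure X :=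
  open Classical in
  Measure.sum fun i : ℕ => if (i : ℕ∞) < a.1 then Measure.dirac (a.2 i) else 0

/-- A Poisson process with intensity `Λ`, given by an enumeration of its points, with independent
marks of law `μ`. -/
structure IsMarkedPoisson (pts : Ω → ℕ∞ × (ℕ → X)) (mark : Ω → ℕ → E) (Λ : Measure X)
    (μ : Measure E) (P : Measure Ω) : Prop where
  measurable_pts : Measurable pts
  measurable_mark : Measurable mark
  poisson : IsPoissonPP (fun ω => countingMeasure (pts ω)) Λ P
  law_mark : ∀ i, HasLaw (fun ω => mark ω i) μ P
  indep_mark : iIndepFun (fun i ω => mark ω i) P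
  indep : IndepFun pts mark P

theorem lintegral_countingMeasure {f : X → ℝ≥0∞} (hf : Measurable f) (a : ℕ∞ × (ℕ → X)) :
    open Classical in
    ∫⁻ x, f x ∂countingMeasure a = ∑' i : ℕ, if (i : ℕ∞) < a.1 then f (a.2 i) else 0 := by
  rw [countingMeasure, lintegral_sum_measure]
  refine tsum_congr fun i => ?_
  split_ifs
  · exact lintegral_dirac' _ hf
  · exact lintegral_zero_measure _

theorem measurable_uncurry_shotNoise {f : X → E → ℝ≥0∞} (hf : Measurable (Function.uncurry f)) :
    Measurable (Function.uncurry (shotNoise f)) := by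
  refine Measurable.tsum fun i => Measurable.ite ?_ ?_ measurable_const
  · exact (measurable_fst.comp measurable_fst)
      (MeasurableSet.of_discrete (s := {n : ℕ∞ | (i : ℕ∞) < n}))
  · have hpair : Measurable fun q : (ℕ∞ × (ℕ → X)) × (ℕ → E) => (q.1.2 i, q.2 i) := by fun_prop
    exact hf.comp hpair

namespace IsMarkedPoisson

variable {pts : Ω → ℕ∞ × (ℕ → X)} {mark : Ω → ℕ → E} {Λ : Measure X} {μ : Measure E}
  {P : Measure Ω}

theorem measurable_mark_apply (h : IsMarkedPoisson pts mark Λ μ P) (i : ℕ) :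
    Measurable fun ω => mark ω i :=
  (measurable_pi_apply i).comp h.measurable_mark

theorem measurable_shotNoise (h : IsMarkedPoisson pts mark Λ μ P) {f : X → E → ℝ≥0∞}
    (hf : Measurable (Function.uncurry f)) :
    Measurable fun ω => shotNoise f (pts ω) (mark ω) :=
  (measurable_uncurry_shotNoise hf).comp (h.measurable_pts.prodMk h.measurable_mark)

theorem lintegral_comp_mark (h : IsMarkedPoisson pts mark Λ μ P) {g : E → ℝ≥0∞}
    (hg : Measurable g) (i : ℕ) : ∫⁻ ω, g (mark ω i) ∂P = ∫⁻ m, g m ∂μ := by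
  rw [← (h.law_mark i).map_eq, lintegral_map hg (h.measurable_mark_apply i)]

variable [IsProbabilityMeasure P]

theorem isProbabilityMeasure_markLaw (h : IsMarkedPoisson pts mark Λ μ P) :
    IsProbabilityMeasure μ :=
  (h.law_mark 0).isProbabilityMeasure_iff.1 inferInstance

theorem lintegral_shotNoise (h : IsMarkedPoisson pts mark Λ μ P) [SigmaFinite Λ]
    {f : X → E → ℝ≥0∞} (hf : Measurable (Function.uncurry f)) :
    ∫⁻ ω, shotNoise f (pts ω) (mark ω) ∂P = ∫⁻ x, ∫⁻ m, f x m ∂μ ∂Λ := by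
  have := h.isProbabilityMeasure_markLaw
  have hmean : Measurable fun x => ∫⁻ m, f x m ∂μ := hf.lintegral_prod_right'
  have hfix : ∀ a, ∫⁻ ω, shotNoise f a (mark ω) ∂P =
      ∫⁻ x, ∫⁻ m, f x m ∂μ ∂countingMeasure a := fun a => by
    have hterm : ∀ i, Measurable fun ω => f (a.2 i) (mark ω i) := fun i =>
      hf.of_uncurry_left.comp (h.measurable_mark_apply i)
    rw [lintegral_countingMeasure hmean]
    unfold shotNoise
    rw [lintegral_tsum fun i => ?_]
    · refine tsum_congr fun i => ?_
      split_ifs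
      · exact h.lintegral_comp_mark hf.of_uncurry_left i
      · simp
    · split_ifs
      · exact (hterm i).aemeasurable
      · exact aemeasurable_const
  rw [lintegral_comp_prodMk_of_indepFun h.indep h.measurable_pts h.measurable_mark
    (measurable_uncurry_shotNoise hf)]
  simp_rw [hfix]
  exact h.poisson.lintegral_lintegral hmean

theorem lintegral_expNeg_shotNoise (h : IsMarkedPoisson pts mark Λ μ P) [SigmaFinite Λ]
    {f : X → E → ℝ≥0∞} (hf : Measurable (Function.uncurry f)) :
    ∫⁻ ω, expNeg (shotNoise f (pts ω) (mark ω)) ∂P =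
      expNeg (∫⁻ x, (1 - ∫⁻ m, expNeg (f x m) ∂μ) ∂Λ) := by
  have := h.isProbabilityMeasure_markLaw
  set v : X → ℝ≥0∞ := fun x => negLog (∫⁻ m, expNeg (f x m) ∂μ)
  have hvm : Measurable v :=
    measurable_negLog.comp (measurable_expNeg.comp hf).lintegral_prod_right'
  have hexpv : ∀ x, expNeg (v x) = ∫⁻ m, expNeg (f x m) ∂μ := fun x =>
    expNeg_negLog (lintegral_expNeg_le_one μ _)
  have hfix : ∀ a, ∫⁻ ω, expNeg (shotNoise f a (mark ω)) ∂P =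
      expNeg (∫⁻ x, v x ∂countingMeasure a) := fun a => by
    classical
    have hmeas : ∀ i : ℕ, Measurable fun m => if (i : ℕ∞) < a.1 then f (a.2 i) m else 0 :=
      fun i => by
        split_ifs
        · exact hf.of_uncurry_left
        · exact measurable_const
    rw [lintegral_countingMeasure hvm]
    unfold shotNoise
    have htsum := lintegral_expNeg_tsum (fun i => (hmeas i).comp (h.measurable_mark_apply i))
      (h.indep_mark.comp _ hmeas)
    refine htsum.trans (congrArg expNeg (tsum_congr fun i => ?_))
    simp only [Function.comp_apply]
    split_ifs
    · exact congrArg negLog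
        (h.lintegral_comp_mark (measurable_expNeg.comp hf.of_uncurry_left) i)
    · simp [expNeg_zero, negLog]
  rw [lintegral_comp_prodMk_of_indepFun h.indep h.measurable_pts h.measurable_mark
    (g := fun a m => expNeg (shotNoise f a m))
    (measurable_expNeg.comp (measurable_uncurry_shotNoise hf))]
  simp_rw [hfix]
  rw [h.poisson.lintegral_expNeg_lintegral hvm]
  simp_rw [hexpv]

end IsMarkedPoisson

end Marked

/-! ### Radial integrals in the plane -/

section Radial

theorem integral_norm_plane (g : ℝ → ℝ) :
    ∫ x : Plane, g ‖x‖ = 2 * Real.pi * ∫ r in Ioi 0, g r * r := by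
  have hball : (volume : Measure Plane).real (Metric.ball 0 1) = Real.pi := by
    simp [measureReal_def, EuclideanSpace.volume_ball_fin_two, Real.pi_pos.le]
  rw [integral_fun_norm_addHaar (volume : Measure Plane) g, hball]
  simp only [finrank_euclideanSpace_fin, Nat.add_one_sub_one, pow_one, smul_eq_mul, nsmul_eq_mul,
    Nat.cast_ofNat, mul_comm, mul_assoc, mul_left_comm]

theorem integrable_norm_plane {g : ℝ → ℝ} (hg : IntegrableOn (fun r => g r * r) (Ioi 0)) :
    Integrable fun x : Plane => g ‖x‖ := by
  rw [integrable_fun_norm_addHaar]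
  simpa [mul_comm] using hg

variable {ρ g : ℝ → ℝ} {d : ℝ}

theorem lintegral_radial_eq (hρ : ∀ r, 0 ≤ r → 0 ≤ ρ r) (hρm : Measurable ρ) (hg : Measurable g)
    (d : ℝ) :
    ∫⁻ x : Plane, (if d ≤ ‖x‖ then ENNReal.ofReal (g ‖x‖) else 0)
      ∂volume.withDensity (fun x => ENNReal.ofReal (ρ ‖x‖)) =
      ∫⁻ x : Plane, ENNReal.ofReal ((Ici d).indicator (fun r => ρ r * g r) ‖x‖) := by
  have hm : Measurable fun x : Plane => if d ≤ ‖x‖ then ENNReal.ofReal (g ‖x‖) else 0 :=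
    Measurable.ite (measurableSet_le measurable_const measurable_norm) (by fun_prop)
      measurable_const
  rw [lintegral_withDensity_eq_lintegral_mul _ (by fun_prop) hm]
  refine lintegral_congr fun x => ?_
  simp only [Pi.mul_apply, indicator, mem_Ici]
  split_ifs
  · rw [ENNReal.ofReal_mul (hρ _ (norm_nonneg x))]
  · simp

theorem setIntegral_Ioi_zero_indicator_mul (hd : 0 < d) (h : ℝ → ℝ) :
    ∫ r in Ioi 0, (Ici d).indicator h r * r = ∫ r in Ioi d, h r * r := by
  simp_rw [← indicator_mul_left (Ici d) h fun r => r]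
  rw [setIntegral_indicator measurableSet_Ici, inter_eq_right.2 (Ici_subset_Ioi.2 hd),
    integral_Ici_eq_integral_Ioi]

theorem toReal_lintegral_radial (hρ : ∀ r, 0 ≤ r → 0 ≤ ρ r) (hρm : Measurable ρ)
    (hg : ∀ r, 0 ≤ r → 0 ≤ g r) (hgm : Measurable g) (hd : 0 < d) :
    (∫⁻ x : Plane, (if d ≤ ‖x‖ then ENNReal.ofReal (g ‖x‖) else 0)
      ∂volume.withDensity fun x => ENNReal.ofReal (ρ ‖x‖)).toReal =
      2 * Real.pi * ∫ r in Ioi d, ρ r * g r * r := by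
  have hmeas : Measurable ((Ici d).indicator fun r => ρ r * g r) :=
    (hρm.mul hgm).indicator measurableSet_Ici
  have hpos : ∀ r, 0 ≤ (Ici d).indicator (fun r => ρ r * g r) r :=
    indicator_nonneg fun r hr => mul_nonneg (hρ r (hd.le.trans hr)) (hg r (hd.le.trans hr))
  rw [lintegral_radial_eq hρ hρm hgm, ← integral_eq_lintegral_of_nonneg_ae
    (ae_of_all _ fun x => hpos ‖x‖) (hmeas.comp measurable_norm).aestronglyMeasurable,
    integral_norm_plane, setIntegral_Ioi_zero_indicator_mul hd]

theorem lintegral_radial_ne_top (hρ : ∀ r, 0 ≤ r → 0 ≤ ρ r) (hρm : Measurable ρ)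
    (hgm : Measurable g) (hint : IntegrableOn (fun r => ρ r * g r * r) (Ioi d)) :
    ∫⁻ x : Plane, (if d ≤ ‖x‖ then ENNReal.ofReal (g ‖x‖) else 0)
      ∂volume.withDensity (fun x => ENNReal.ofReal (ρ ‖x‖)) ≠ ∞ := by
  rw [lintegral_radial_eq hρ hρm hgm]
  refine (integrable_norm_plane (Integrable.integrableOn ?_)).lintegral_lt_top.ne
  simp_rw [← indicator_mul_left (Ici d) (fun r => ρ r * g r) fun r => r]
  rwa [integrable_indicator_iff measurableSet_Ici, integrableOn_Ici_iff_integrableOn_Ioi]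

end Radial

/-! ### Parameters of the processes of interferers -/

namespace Params

variable {p : Params}

/-- Shape of the Gamma law of the marks; the exponential law has shape `1`. -/
def markShape (p : Params) : Kind → ℝ
  | .target => 1
  | .los => p.mL
  | .nlos => p.mN

/-- Rate of the Gamma law of the marks. -/
def markRate (p : Params) : Kind → ℝ
  | .target => 1 / p.rcsBi
  | .los => p.mL
  | .nlos => p.mN

/-- The intensity of each process of interferers, as a function of the distance to the origin. -/
def radialDensity (p : Params) (j : Kind) (r : ℝ) : ℝ :=
  match j with
  | .target => p.lamBS * p.pLOS r * (p.Nb * p.thetaB / (2 * Real.pi))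
  | .los => p.pLOS r * p.lamI
  | .nlos => (1 - p.pLOS r) * p.lamI

/-- Noise and residual self-interference. -/
def noisePower (p : Params) : ℝ := p.KB * p.T * p.W + p.Pc * p.zetaSI

theorem markLaw_eq (p : Params) (j : Kind) :
    p.markLaw j = gammaMeasure (p.markShape j) (p.markRate j) := by
  cases j <;> rfl

theorem intensity_eq (p : Params) (j : Kind) :
    p.intensity j = volume.withDensity fun x => ENNReal.ofReal (p.radialDensity j ‖x‖) := by
  cases j <;> rfl

instance sigmaFinite_intensity (p : Params) (j : Kind) : SigmaFinite (p.intensity j) := by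
  rw [intensity_eq]
  exact SigmaFinite.withDensity_ofReal _

theorem measurable_radialDensity (p : Params) (j : Kind) : Measurable (p.radialDensity j) := by
  unfold radialDensity pLOS
  cases j <;> fun_prop

theorem measurable_densRT (p : Params) (K : ℕ) (R₁ : ℝ) : Measurable (p.densRT K R₁) :=
  Measurable.ite measurableSet_Ici (by fun_prop) measurable_const

theorem measurable_densRI (p : Params) : Measurable p.densRI :=
  Measurable.ite measurableSet_Ioi (by fun_prop) measurable_const

theorem pLOS_pos (p : Params) (r : ℝ) : 0 < p.pLOS r := Real.exp_pos _

theorem xi_eq (p : Params) : p.xi = 2 * Real.pi * p.lamI := by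
  unfold xi lamI
  ring

namespace Valid

theorem markShape_pos (hp : p.Valid) (j : Kind) : 0 < p.markShape j := by
  cases j
  exacts [one_pos, hp.mL_pos, hp.mN_pos]

theorem markRate_pos (hp : p.Valid) (j : Kind) : 0 < p.markRate j := by
  cases j
  exacts [one_div_pos.2 hp.rcsBi_pos, hp.mL_pos, hp.mN_pos]

theorem lamI_nonneg (hp : p.Valid) : 0 ≤ p.lamI := by
  have := hp.lamBS_pos
  have := hp.thetaB_pos
  unfold lamI
  positivity

theorem noisePower_pos (hp : p.Valid) : 0 < p.noisePower :=
  add_pos_of_pos_of_nonneg (mul_pos (mul_pos hp.KB_pos hp.T_pos) hp.W_pos)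
    (mul_nonneg hp.Pc_nonneg hp.zetaSI_nonneg)

theorem amplitude_nonneg (hp : p.Valid) {R₁ : ℝ} (hR : 0 < R₁) (j : Kind) :
    0 ≤ p.amplitude R₁ j := by
  have := hp.Ps_pos
  have := hp.Pc_nonneg
  have := hp.CL_pos
  have := hp.CN_pos
  cases j <;> simp only [amplitude] <;> positivity

theorem densRI_nonneg (hp : p.Valid) (r : ℝ) : 0 ≤ p.densRI r := by
  have := hp.lamBS_pos
  unfold densRI
  split_ifs <;> positivity

theorem densRT_nonneg (hp : p.Valid) (K : ℕ) {R₁ : ℝ} (hR : 0 < R₁) (r : ℝ) :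
    0 ≤ p.densRT K R₁ r := by
  have := hp.lamBS_pos
  unfold densRT
  split_ifs with h
  · have : 0 ≤ r ^ 2 - R₁ ^ 2 := sub_nonneg.2 (by gcongr)
    have : 0 ≤ r := hR.le.trans h
    positivity
  · exact le_rfl

theorem pLOS_le_one (hp : p.Valid) {r : ℝ} (hr : 0 ≤ r) : p.pLOS r ≤ 1 :=
  Real.exp_le_one_iff.2 (neg_nonpos.2 (mul_nonneg hp.etaB_pos.le hr))

theorem radialDensity_nonneg (hp : p.Valid) (j : Kind) {r : ℝ} (hr : 0 ≤ r) :
    0 ≤ p.radialDensity j r := by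
  have := hp.lamBS_pos
  have := hp.thetaB_pos
  have hlos := p.pLOS_pos r
  cases j
  · simp only [radialDensity]; positivity
  · exact mul_nonneg hlos.le hp.lamI_nonneg
  · exact mul_nonneg (sub_nonneg.2 (hp.pLOS_le_one hr)) hp.lamI_nonneg

theorem integrableOn_pLOS_mul_rpow (hp : p.Valid) {d : ℝ} (hd : 0 < d) :
    IntegrableOn (fun r => p.pLOS r * r ^ (-p.aL) * r) (Ioi d) := by
  have hint : IntegrableOn (fun r => d ^ (-p.aL) * (r ^ ((2 : ℝ) - 1) * Real.exp (-(p.etaB * r))))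
      (Ioi d) :=
    ((integrableOn_rpow_mul_exp_neg_mul two_pos hp.etaB_pos).mono_set
      (Ioi_subset_Ioi hd.le)).const_mul _
  refine hint.mono' (by unfold pLOS; fun_prop) ?_
  filter_upwards [ae_restrict_mem measurableSet_Ioi] with r hr
  have hr0 : 0 < r := hd.trans hr
  have hlos := p.pLOS_pos r
  have hpow : r ^ (-p.aL) ≤ d ^ (-p.aL) :=
    Real.rpow_le_rpow_of_nonpos hd (le_of_lt hr) (neg_nonpos.2 hp.aL_pos.le)
  rw [Real.norm_of_nonneg (by positivity), show (2 : ℝ) - 1 = 1 by norm_num, Real.rpow_one]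
  calc p.pLOS r * r ^ (-p.aL) * r ≤ p.pLOS r * d ^ (-p.aL) * r := by gcongr
    _ = d ^ (-p.aL) * (r * Real.exp (-(p.etaB * r))) := by rw [pLOS]; ring

theorem integrableOn_one_sub_pLOS_mul_rpow (hp : p.Valid) {d : ℝ} (hd : 0 < d) :
    IntegrableOn (fun r => (1 - p.pLOS r) * r ^ (-p.aN) * r) (Ioi d) := by
  have hint : IntegrableOn (fun r => r ^ (-p.aN + 1)) (Ioi d) :=
    integrableOn_Ioi_rpow_of_lt (by linarith [hp.two_lt_aN]) hd
  refine hint.mono' (by unfold pLOS; fun_prop) ?_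
  filter_upwards [ae_restrict_mem measurableSet_Ioi] with r hr
  have hr0 : 0 < r := hd.trans hr
  have hlos : 0 ≤ 1 - p.pLOS r := sub_nonneg.2 (hp.pLOS_le_one hr0.le)
  rw [Real.norm_of_nonneg (by positivity), Real.rpow_add_one hr0.ne', mul_assoc]
  exact mul_le_of_le_one_left (by positivity) (sub_le_self _ (p.pLOS_pos r).le)

theorem integrableOn_radialDensity (hp : p.Valid) (j : Kind) {d : ℝ} (hd : 0 < d) :
    IntegrableOn (fun r => p.radialDensity j r * r ^ (-p.exponent j) * r) (Ioi d) := by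
  cases j
  · refine IntegrableOn.congr_fun ((hp.integrableOn_pLOS_mul_rpow hd).const_mul
      (p.lamBS * (p.Nb * p.thetaB / (2 * Real.pi)))) (fun r _ => ?_) measurableSet_Ioi
    simp only [radialDensity, exponent]
    ring
  · refine IntegrableOn.congr_fun ((hp.integrableOn_pLOS_mul_rpow hd).const_mul p.lamI)
      (fun r _ => ?_) measurableSet_Ioi
    simp only [radialDensity, exponent]
    ring
  · refine IntegrableOn.congr_fun ((hp.integrableOn_one_sub_pLOS_mul_rpow hd).const_mul p.lamI)
      (fun r _ => ?_) measurableSet_Ioi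
    simp only [radialDensity, exponent]
    ring

end Valid

end Params

namespace Network

variable {K : ℕ} {Ω : Type*} {M : Network K Ω}

/-! ### The sources of randomness -/

/-- The points of a process of interferers, as an enumeration. -/
def pts (M : Network K Ω) (j : Kind) (ω : Ω) : ℕ∞ × (ℕ → Plane) :=
  (M.count j ω, fun i => M.pos j i ω)

/-- The marks of a process of interferers, as a sequence. -/
def marks (M : Network K Ω) (j : Kind) (ω : Ω) (i : ℕ) : ℝ := M.mark j i ω

/-- The values of the points and marks of a process of interferers. -/
abbrev MarkedPoints : Type := (ℕ∞ × (ℕ → Plane)) × (ℕ → ℝ)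

/-- The points and the marks of a process of interferers. -/
def markedPts (M : Network K Ω) (j : Kind) (ω : Ω) : MarkedPoints := (M.pts j ω, M.marks j ω)

/-- The sources of randomness of a process of interferers. -/
def markedSources (K : ℕ) (j : Kind) : Set (Source K) :=
  {i | i = .points j ∨ ∃ n, i = .mark j n}

/-- The sources of randomness of the target-reflected interference. -/
def targetSources (K : ℕ) : Set (Source K) := insert .radT (markedSources K .target)

/-- The sources of randomness of the co-channel interference. -/
def directSources (K : ℕ) : Set (Source K) :=
  insert .radI (markedSources K .los ∪ markedSources K .nlos)

/-- The sources of randomness of the echo power. -/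
def echoSources (K : ℕ) : Set (Source K) :=
  {i | i = .mono ∨ (∃ n, i = .bi n) ∨ ∃ n, i = .lit n}

theorem disjoint_markedSources : Disjoint (markedSources K .los) (markedSources K .nlos) := by
  rw [Set.disjoint_left]
  rintro i (rfl | ⟨n, rfl⟩) <;> simp [markedSources]

theorem disjoint_targetSources_directSources :
    Disjoint (targetSources K) (directSources K) := by
  rw [Set.disjoint_left]
  rintro i (rfl | rfl | ⟨n, rfl⟩) <;> simp [directSources, markedSources]

theorem disjoint_echoSources : Disjoint (echoSources K) (targetSources K ∪ directSources K) := by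
  rw [Set.disjoint_left]
  rintro i (rfl | ⟨n, rfl⟩ | ⟨n, rfl⟩) <;> simp [targetSources, directSources, markedSources]

/-- The σ-algebra generated by a set of sources of randomness. -/
@[reducible]
def gen (M : Network K Ω) (S : Set (Source K)) : MeasurableSpace Ω := ⨆ i ∈ S, M.sigma i

theorem sigma_le_gen {S : Set (Source K)} {i : Source K} (hi : i ∈ S) : M.sigma i ≤ M.gen S :=
  le_biSup M.sigma hi

theorem measurable_gen_of_comap {S : Set (Source K)} {i : Source K} (hi : i ∈ S) {E : Type*}
    {mE : MeasurableSpace E} {f : Ω → E} (hf : mE.comap f ≤ M.sigma i) : Measurable[M.gen S] f :=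
  measurable_iff_comap_le.2 (hf.trans (sigma_le_gen hi))

theorem measurable_gen_rcsMono {S : Set (Source K)} (h : .mono ∈ S) :
    Measurable[M.gen S] M.rcsMono := measurable_gen_of_comap h le_rfl

theorem measurable_gen_rcsBi {S : Set (Source K)} {n : Fin K} (h : .bi n ∈ S) :
    Measurable[M.gen S] (M.rcsBi n) := measurable_gen_of_comap h le_rfl

theorem measurableSet_gen_lit {S : Set (Source K)} {n : Fin K} (h : .lit n ∈ S) :
    MeasurableSet[M.gen S] (M.lit n) :=
  sigma_le_gen h _ (MeasurableSpace.measurableSet_generateFrom rfl)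

theorem measurable_gen_radT {S : Set (Source K)} (h : .radT ∈ S) :
    Measurable[M.gen S] M.radT := measurable_gen_of_comap h le_rfl

theorem measurable_gen_radI {S : Set (Source K)} (h : .radI ∈ S) :
    Measurable[M.gen S] M.radI := measurable_gen_of_comap h le_rfl

theorem measurable_gen_pts {S : Set (Source K)} {j : Kind} (h : .points j ∈ S) :
    Measurable[M.gen S] (M.pts j) := measurable_gen_of_comap h le_rfl

theorem measurable_gen_marks {S : Set (Source K)} {j : Kind} (h : ∀ i, .mark j i ∈ S) :
    Measurable[M.gen S] (M.marks j) :=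
  @measurable_pi_lambda _ _ _ (M.gen S) _ _ fun i => measurable_gen_of_comap (h i) le_rfl

theorem measurable_gen_markedPts {S : Set (Source K)} {j : Kind} (h : markedSources K j ⊆ S) :
    Measurable[M.gen S] (M.markedPts j) :=
  Measurable.prodMk (m := M.gen S) (measurable_gen_pts (h (Or.inl rfl)))
    (measurable_gen_marks fun i => h (Or.inr ⟨i, rfl⟩))

namespace IsModel

variable [MeasurableSpace Ω] {p : Params} {R : Fin (K + 1) → ℝ} {P : Measure Ω}

theorem isProbabilityMeasure (hM : M.IsModel p R P) (hp : p.Valid) : IsProbabilityMeasure P := by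
  have := isProbabilityMeasure_expMeasure (one_div_pos.2 hp.rcsMono_pos)
  exact hM.law_rcsMono.isProbabilityMeasure_iff.2 this

theorem measurable_pts (hM : M.IsModel p R P) (j : Kind) : Measurable (M.pts j) :=
  (hM.measurable_count j).prodMk (measurable_pi_lambda _ fun i => hM.measurable_pos j i)

theorem measurable_marks (hM : M.IsModel p R P) (j : Kind) : Measurable (M.marks j) :=
  measurable_pi_lambda _ fun i => hM.measurable_mark j i

theorem measurable_markedPts (hM : M.IsModel p R P) (j : Kind) : Measurable (M.markedPts j) :=
  (hM.measurable_pts j).prodMk (hM.measurable_marks j)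

theorem sigma_le (hM : M.IsModel p R P) (i : Source K) : M.sigma i ≤ ‹MeasurableSpace Ω› := by
  cases i with
  | mono => exact hM.measurable_rcsMono.comap_le
  | bi n => exact (hM.measurable_rcsBi n).comap_le
  | lit n =>
    exact MeasurableSpace.generateFrom_le fun s hs => by
      rw [mem_singleton_iff.1 hs]; exact hM.measurable_lit n
  | radT => exact hM.measurable_radT.comap_le
  | radI => exact hM.measurable_radI.comap_le
  | points j => exact (hM.measurable_pts j).comap_le
  | mark j i => exact (hM.measurable_mark j i).comap_le

theorem gen_le (hM : M.IsModel p R P) (S : Set (Source K)) : M.gen S ≤ ‹MeasurableSpace Ω› :=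
  iSup₂_le fun i _ => hM.sigma_le i

theorem indepFun (hM : M.IsModel p R P) {S T : Set (Source K)} (hST : Disjoint S T)
    {E F : Type*} [MeasurableSpace E] [MeasurableSpace F] {f : Ω → E} {g : Ω → F}
    (hf : Measurable[M.gen S] f) (hg : Measurable[M.gen T] g) : IndepFun f g P :=
  (IndepFun_iff_Indep f g P).2 (indep_of_indep_of_le_left (indep_of_indep_of_le_right
    (indep_iSup_of_disjoint hM.sigma_le hM.indep hST) hg.comap_le) hf.comap_le)

theorem isMarkedPoisson (hM : M.IsModel p R P) (j : Kind) :
    IsMarkedPoisson (M.pts j) (M.marks j) (p.intensity j) (p.markLaw j) P where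
  measurable_pts := hM.measurable_pts j
  measurable_mark := hM.measurable_marks j
  poisson := hM.poisson j
  law_mark := hM.law_mark j
  indep_mark := (iIndepFun_iff_iIndep _ _ _).2
    (hM.indep.precomp (g := fun i : ℕ => Source.mark j i) fun a b hab => by simpa using hab)
  indep := hM.indepFun (S := {.points j}) (T := {i | ∃ n, i = .mark j n})
    (disjoint_singleton_left.2 (by simp)) (measurable_gen_pts rfl)
    (measurable_gen_marks fun i => ⟨i, rfl⟩)

theorem ae_mark_nonneg (hM : M.IsModel p R P) : ∀ᵐ ω ∂P, ∀ j i, 0 ≤ M.mark j i ω := by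
  have hkind : ∀ j, ∀ᵐ ω ∂P, ∀ i, 0 ≤ M.mark j i ω := fun j => ae_all_iff.2 fun i => by
    refine ((hM.law_mark j i).ae_iff (p := fun x => 0 ≤ x)
      (measurableSet_setOfPred.1 measurableSet_Ici)).2 ?_
    rw [p.markLaw_eq]
    filter_upwards [ae_gammaMeasure_pos (p.markShape j) (p.markRate j)] with x hx using hx.le
  filter_upwards [hkind .target, hkind .los, hkind .nlos] with ω htarget hlos hnlos j
  cases j
  exacts [htarget, hlos, hnlos]

theorem ae_radI_pos (hM : M.IsModel p R P) : ∀ᵐ ω ∂P, 0 < M.radI ω := by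
  refine (hM.law_radI.ae_iff (p := fun x => 0 < x)
    (measurableSet_setOfPred.1 measurableSet_Ioi)).2 ?_
  rw [ae_withDensity_iff p.measurable_densRI.ennreal_ofReal]
  refine ae_of_all _ fun r hr => ?_
  by_contra h
  exact hr (by simp [Params.densRI, h])

theorem ae_le_radT (hM : M.IsModel p R P) : ∀ᵐ ω ∂P, R 0 ≤ M.radT ω := by
  refine (hM.law_radT.ae_iff (p := fun x => R 0 ≤ x)
    (measurableSet_setOfPred.1 measurableSet_Ici)).2 ?_
  rw [ae_withDensity_iff (p.measurable_densRT K (R 0)).ennreal_ofReal]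
  refine ae_of_all _ fun r hr => ?_
  by_contra h
  exact hr (by simp [Params.densRT, h])

theorem ae_radius_pos (hM : M.IsModel p R P) (hR : 0 < R 0) :
    ∀ᵐ ω ∂P, ∀ j, 0 < M.radius j ω := by
  filter_upwards [hM.ae_radI_pos, hM.ae_le_radT] with ω hI hT j
  cases j
  exacts [hR.trans_le hT, hI, hI]

end IsModel

end Network

/-! ### Interference at a fixed exclusion radius -/

section PathGain

/-- The contribution `m ‖x‖^(-α)` of an interferer at `x` with mark `m`, provided that `x` lies
outside the exclusion disk of radius `d`. -/
def pathGain (α d : ℝ) (x : Plane) (m : ℝ) : ℝ≥0∞ :=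
  if d ≤ ‖x‖ then ENNReal.ofReal (m * ‖x‖ ^ (-α)) else 0

theorem measurable_uncurry_pathGain (α d : ℝ) : Measurable (Function.uncurry (pathGain α d)) :=
  Measurable.ite (measurableSet_le measurable_const measurable_fst.norm) (by fun_prop)
    measurable_const

theorem pathGain_ne_top (α d : ℝ) (x : Plane) (m : ℝ) : pathGain α d x m ≠ ∞ := by
  unfold pathGain
  split_ifs <;> simp

theorem antitone_pathGain (α : ℝ) (x : Plane) (m : ℝ) : Antitone fun d => pathGain α d x m :=
  fun d d' hd => by
    simp only [pathGain]
    split_ifs with h h'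
    exacts [le_rfl, absurd (hd.trans h) h', zero_le, le_rfl]

theorem lintegral_pathGain (μ : Measure ℝ) (α d : ℝ) (x : Plane) :
    ∫⁻ m, pathGain α d x m ∂μ =
      (∫⁻ m, ENNReal.ofReal m ∂μ) * if d ≤ ‖x‖ then ENNReal.ofReal (‖x‖ ^ (-α)) else 0 := by
  simp only [pathGain]
  split_ifs with h
  · simp_rw [ENNReal.ofReal_mul' (Real.rpow_nonneg (norm_nonneg x) (-α))]
    exact lintegral_mul_const _ ENNReal.measurable_ofReal
  · simp

theorem one_sub_lintegral_expNeg_pathGain {a r c : ℝ} (ha : 0 < a) (hr : 0 < r) (hc : 0 ≤ c)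
    (α d : ℝ) (x : Plane) :
    1 - ∫⁻ m, expNeg (ENNReal.ofReal c * pathGain α d x m) ∂gammaMeasure a r =
      if d ≤ ‖x‖ then ENNReal.ofReal (1 - (1 + c * ‖x‖ ^ (-α) / r) ^ (-a)) else 0 := by
  have := isProbabilityMeasure_gammaMeasure ha hr
  have : 0 ≤ ‖x‖ ^ (-α) := Real.rpow_nonneg (norm_nonneg x) _
  by_cases hd : d ≤ ‖x‖
  · have hexp : ∀ᵐ m ∂gammaMeasure a r, expNeg (ENNReal.ofReal c * pathGain α d x m) =
        ENNReal.ofReal (Real.exp (-(c * ‖x‖ ^ (-α) * m))) := by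
      filter_upwards [ae_gammaMeasure_pos a r] with m hm
      rw [pathGain, if_pos hd, ← ENNReal.ofReal_mul hc, expNeg_ofReal (by positivity)]
      ring_nf
    have hint : Integrable (fun m => Real.exp (-(c * ‖x‖ ^ (-α) * m))) (gammaMeasure a r) := by
      refine Integrable.of_bound (by fun_prop) 1 ?_
      filter_upwards [ae_gammaMeasure_pos a r] with m hm
      rw [Real.norm_of_nonneg (Real.exp_pos _).le]
      exact Real.exp_le_one_iff.2 (neg_nonpos.2 (by positivity))
    rw [if_pos hd, lintegral_congr_ae hexp, ← ofReal_integral_eq_lintegral_ofReal hint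
      (ae_of_all _ fun m => (Real.exp_pos _).le),
      integral_exp_neg_gammaMeasure ha hr (by positivity),
      ← ENNReal.ofReal_one, ← ENNReal.ofReal_sub _ (by positivity)]
  · simp [pathGain, hd, expNeg_zero]

theorem measurable_shotNoise_pathGain (α : ℝ) :
    Measurable fun q : ℝ × Network.MarkedPoints => shotNoise (pathGain α q.1) q.2.1 q.2.2 := by
  refine Measurable.tsum fun i => Measurable.ite ?_ ?_ measurable_const
  · exact (measurable_fst.comp (measurable_fst.comp measurable_snd))
      (MeasurableSet.of_discrete (s := {n : ℕ∞ | (i : ℕ∞) < n}))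
  · exact Measurable.ite (measurableSet_le (by fun_prop) (by fun_prop)) (by fun_prop)
      measurable_const

end PathGain

namespace Params

variable {p : Params}

/-- The interference received from given marked points, at a given exclusion radius. -/
def interfAt (p : Params) (R₁ : ℝ) (j : Kind) (q : ℝ × Network.MarkedPoints) : ℝ :=
  p.amplitude R₁ j * (shotNoise (pathGain (p.exponent j) q.1) q.2.1 q.2.2).toReal

/-- Minus the logarithm of the Laplace transform at `s` of the interference, at a fixed exclusion
radius `d`. -/
def lapExponent (p : Params) (R₁ : ℝ) (j : Kind) (s d : ℝ) : ℝ :=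
  2 * Real.pi * ∫ r in Ioi d, p.radialDensity j r *
    (1 - (1 + s * p.amplitude R₁ j * r ^ (-p.exponent j) / p.markRate j) ^ (-p.markShape j)) * r

theorem measurable_interfAt (p : Params) (R₁ : ℝ) (j : Kind) : Measurable (p.interfAt R₁ j) :=
  (measurable_shotNoise_pathGain _).ennreal_toReal.const_mul _

theorem lapExponent_los (p : Params) (R₁ s d : ℝ) :
    p.lapExponent R₁ .los s d = p.xi * p.JL s d := by
  rw [lapExponent, xi_eq, JL, ← integral_const_mul, ← integral_const_mul]
  refine integral_congr_ae (ae_of_all _ fun r => ?_)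
  simp only [radialDensity, amplitude, exponent, markRate, markShape, mul_assoc]
  ring_nf

theorem lapExponent_nlos (p : Params) (R₁ s d : ℝ) :
    p.lapExponent R₁ .nlos s d = p.xi * p.JN s d := by
  rw [lapExponent, xi_eq, JN, ← integral_const_mul, ← integral_const_mul]
  refine integral_congr_ae (ae_of_all _ fun r => ?_)
  simp only [radialDensity, amplitude, exponent, markRate, markShape, mul_assoc]
  ring_nf

theorem lapExponent_target (p : Params) (R₁ s : ℝ) {d : ℝ} (hd : 0 < d) :
    p.lapExponent R₁ .target s d = p.lamBS * p.Nb * p.thetaB *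
      ∫ r in Ioi d, p.pLOS r * (1 - 1 / (1 + s * p.muBi R₁ r)) * r := by
  rw [lapExponent, ← integral_const_mul, ← integral_const_mul]
  refine setIntegral_congr_fun measurableSet_Ioi fun r hr => ?_
  have hr0 : 0 < r := hd.trans hr
  have hmu : s * p.amplitude R₁ .target * r ^ (-p.aL) / (1 / p.rcsBi) = s * p.muBi R₁ r := by
    rw [amplitude, muBi, echoBi, Real.rpow_neg hr0.le]
    field_simp
  simp only [radialDensity, exponent, markRate, markShape]
  rw [hmu, Real.rpow_neg_one, one_div]
  field_simp

namespace Valid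

theorem interfAt_nonneg (hp : p.Valid) {R₁ : ℝ} (hR : 0 < R₁) (j : Kind)
    (q : ℝ × Network.MarkedPoints) : 0 ≤ p.interfAt R₁ j q :=
  mul_nonneg (hp.amplitude_nonneg hR j) ENNReal.toReal_nonneg

theorem lintegral_lintegral_pathGain_ne_top (hp : p.Valid) (j : Kind) {d : ℝ} (hd : 0 < d) :
    ∫⁻ x, ∫⁻ m, pathGain (p.exponent j) d x m ∂p.markLaw j ∂p.intensity j ≠ ∞ := by
  have hmark : ∫⁻ m, ENNReal.ofReal m ∂p.markLaw j ≠ ∞ := by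
    have := isProbabilityMeasure_gammaMeasure (hp.markShape_pos j) (hp.markRate_pos j)
    rw [p.markLaw_eq]
    exact ((memLp_id_gammaMeasure (hp.markShape_pos j) (hp.markRate_pos j)).integrable
      one_le_two).lintegral_lt_top.ne
  have hmeas : Measurable fun x : Plane =>
      if d ≤ ‖x‖ then ENNReal.ofReal (‖x‖ ^ (-p.exponent j)) else 0 :=
    Measurable.ite (measurableSet_le measurable_const measurable_norm) (by fun_prop)
      measurable_const
  simp_rw [lintegral_pathGain]
  rw [lintegral_const_mul _ hmeas, p.intensity_eq]
  exact ENNReal.mul_ne_top hmark (lintegral_radial_ne_top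
    (fun r hr => hp.radialDensity_nonneg j hr) (p.measurable_radialDensity j) (by fun_prop)
    (hp.integrableOn_radialDensity j hd))

theorem lintegral_one_sub_lintegral_expNeg_ne_top (hp : p.Valid) (j : Kind) (c : ℝ) {d : ℝ}
    (hd : 0 < d) :
    ∫⁻ x, (1 - ∫⁻ m, expNeg (ENNReal.ofReal c * pathGain (p.exponent j) d x m) ∂p.markLaw j)
      ∂p.intensity j ≠ ∞ := by
  have : IsProbabilityMeasure (p.markLaw j) :=
    p.markLaw_eq j ▸ isProbabilityMeasure_gammaMeasure (hp.markShape_pos j) (hp.markRate_pos j)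
  have hgain := measurable_uncurry_pathGain (p.exponent j) d
  have hmean : Measurable fun x => ∫⁻ m, pathGain (p.exponent j) d x m ∂p.markLaw j :=
    hgain.lintegral_prod_right'
  refine ne_top_of_le_ne_top
    (ENNReal.mul_ne_top (ENNReal.ofReal_ne_top (r := c))
      (hp.lintegral_lintegral_pathGain_ne_top j hd)) ?_
  rw [← lintegral_const_mul _ hmean]
  refine lintegral_mono fun x => ?_
  rw [← lintegral_const_mul _ hgain.of_uncurry_left]
  exact one_sub_lintegral_expNeg_le _ (hgain.of_uncurry_left.const_mul _)

theorem toReal_lintegral_one_sub_lintegral_expNeg (hp : p.Valid) {R₁ : ℝ} (hR : 0 < R₁) (j : Kind)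
    {s d : ℝ} (hs : 0 ≤ s) (hd : 0 < d) :
    (∫⁻ x, (1 - ∫⁻ m, expNeg (ENNReal.ofReal (s * p.amplitude R₁ j) *
      pathGain (p.exponent j) d x m) ∂p.markLaw j) ∂p.intensity j).toReal =
      p.lapExponent R₁ j s d := by
  have hrate := hp.markRate_pos j
  have hshape := hp.markShape_pos j
  have hamp := hp.amplitude_nonneg hR j
  rw [p.markLaw_eq, p.intensity_eq]
  simp_rw [one_sub_lintegral_expNeg_pathGain hshape hrate (mul_nonneg hs hamp)]
  refine toReal_lintegral_radial (g := fun r =>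
      1 - (1 + s * p.amplitude R₁ j * r ^ (-p.exponent j) / p.markRate j) ^ (-p.markShape j))
    (fun r hr => hp.radialDensity_nonneg j hr)
    (p.measurable_radialDensity j) (fun r hr => sub_nonneg.2 ?_) (by fun_prop) hd
  exact Real.rpow_le_one_of_one_le_of_nonpos (le_add_of_nonneg_right (by positivity))
    (neg_nonpos.2 hshape.le)

end Valid

end Params

namespace Network

variable {K : ℕ} {Ω : Type*} {M : Network K Ω} {p : Params} {R : Fin (K + 1) → ℝ}

theorem interfTerm_eq_toReal {j : Kind} {ω : Ω} (hω : ∀ i, 0 ≤ M.mark j i ω) (d : ℝ) (i : ℕ) :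
    open Classical in
    M.interfTerm p j d ω i = (if (i : ℕ∞) < (M.pts j ω).1 then
      pathGain (p.exponent j) d ((M.pts j ω).2 i) (M.marks j ω i) else 0).toReal := by
  unfold interfTerm pathGain pts marks
  by_cases hi : (i : ℕ∞) < M.count j ω <;> by_cases hd : d ≤ ‖M.pos j i ω‖ <;>
    simp [hi, hd, hω i, Real.rpow_nonneg]

theorem interf_eq_interfAt {j : Kind} {ω : Ω} (hω : ∀ i, 0 ≤ M.mark j i ω) (d : ℝ) :
    M.interf p R j d ω = p.interfAt (R 0) j (d, M.markedPts j ω) := by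
  unfold interf Params.interfAt markedPts shotNoise
  rw [ENNReal.tsum_toReal_eq fun i => by split_ifs; exacts [pathGain_ne_top _ _ _ _, by simp]]
  simp_rw [interfTerm_eq_toReal hω]

namespace IsModel

variable [MeasurableSpace Ω] {P : Measure Ω}

theorem ae_shotNoise_ne_top (hM : M.IsModel p R P) (hp : p.Valid) (j : Kind) {d : ℝ}
    (hd : 0 < d) :
    ∀ᵐ ω ∂P, shotNoise (pathGain (p.exponent j) d) (M.pts j ω) (M.marks j ω) ≠ ∞ := by
  have := hM.isProbabilityMeasure hp
  have hgain := measurable_uncurry_pathGain (p.exponent j) d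
  filter_upwards [ae_lt_top ((hM.isMarkedPoisson j).measurable_shotNoise hgain)
    ((hM.isMarkedPoisson j).lintegral_shotNoise hgain ▸
      hp.lintegral_lintegral_pathGain_ne_top j hd)] with ω hω using hω.ne

-- The exceptional null set must not depend on the radius: by monotonicity in the radius it suffices
-- to exclude it for the radii `1 / (n + 1)`.
theorem ae_summable_interfTerm (hM : M.IsModel p R P) (hp : p.Valid) (hR : 0 < R 0) :
    ∀ᵐ ω ∂P, ∀ j, Summable (M.interfTerm p j (M.radius j ω) ω) := by
  have hcountable : ∀ j, ∀ᵐ ω ∂P, ∀ n : ℕ,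
      shotNoise (pathGain (p.exponent j) (1 / (n + 1))) (M.pts j ω) (M.marks j ω) ≠ ∞ :=
    fun j => ae_all_iff.2 fun n => hM.ae_shotNoise_ne_top hp j (by positivity)
  have hkind : ∀ j, ∀ᵐ ω ∂P, Summable (M.interfTerm p j (M.radius j ω) ω) := fun j => by
    filter_upwards [hM.ae_radius_pos hR, hM.ae_mark_nonneg, hcountable j] with ω hrad hmark hfin
    obtain ⟨n, hn⟩ := exists_nat_one_div_lt (hrad j)
    simp_rw [funext (interfTerm_eq_toReal (hmark j) (M.radius j ω))]
    refine ENNReal.summable_toReal (ne_top_of_le_ne_top (hfin n) (ENNReal.tsum_le_tsum fun i => ?_))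
    split_ifs
    exacts [antitone_pathGain _ _ _ hn.le, le_rfl]
  filter_upwards [hkind .target, hkind .los, hkind .nlos] with ω htarget hlos hnlos j
  cases j
  exacts [htarget, hlos, hnlos]

theorem laplace_interfAt (hM : M.IsModel p R P) (hp : p.Valid) (hR : 0 < R 0) (j : Kind)
    {s d : ℝ} (hs : 0 ≤ s) (hd : 0 < d) :
    laplace P (fun ω => p.interfAt (R 0) j (d, M.markedPts j ω)) s =
      Real.exp (-p.lapExponent (R 0) j s d) := by
  have := hM.isProbabilityMeasure hp
  have hc := mul_nonneg hs (hp.amplitude_nonneg hR j)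
  set c := s * p.amplitude (R 0) j
  have hscaled : Measurable (Function.uncurry fun x m =>
      ENNReal.ofReal c * pathGain (p.exponent j) d x m) :=
    (measurable_uncurry_pathGain (p.exponent j) d).const_mul _
  have hexp : ∀ᵐ ω ∂P, ENNReal.ofReal
      (Real.exp (-(s * p.interfAt (R 0) j (d, M.markedPts j ω)))) =
      expNeg (shotNoise (fun x m => ENNReal.ofReal c * pathGain (p.exponent j) d x m)
        (M.pts j ω) (M.marks j ω)) := by
    filter_upwards [hM.ae_shotNoise_ne_top hp j hd] with ω hω
    rw [shotNoise_const_mul, expNeg_of_ne_top (ENNReal.mul_ne_top ENNReal.ofReal_ne_top hω),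
      ENNReal.toReal_mul, ENNReal.toReal_ofReal hc, Params.interfAt, ← mul_assoc]
    rfl
  have hmeas : Measurable fun ω => Real.exp (-(s * p.interfAt (R 0) j (d, M.markedPts j ω))) :=
    (((p.measurable_interfAt (R 0) j).comp
      (measurable_const.prodMk (hM.measurable_markedPts j))).const_mul s).neg.exp
  rw [laplace, integral_eq_lintegral_of_nonneg_ae (ae_of_all _ fun ω => (Real.exp_pos _).le)
    hmeas.aestronglyMeasurable, lintegral_congr_ae hexp,
    (hM.isMarkedPoisson j).lintegral_expNeg_shotNoise hscaled,
    expNeg_of_ne_top (hp.lintegral_one_sub_lintegral_expNeg_ne_top j c hd),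
    ENNReal.toReal_ofReal (Real.exp_pos _).le,
    hp.toReal_lintegral_one_sub_lintegral_expNeg hR j hs hd]

end IsModel

end Network

/-! ### Random exclusion radii -/

section Radius

theorem laplace_congr_ae {Ω : Type*} [MeasurableSpace Ω] {P : Measure Ω} {X Y : Ω → ℝ}
    (h : X =ᵐ[P] Y) (s : ℝ) : laplace P X s = laplace P Y s :=
  integral_congr_ae (h.mono fun ω hω => by simp only [hω])

theorem laplace_add_of_indepFun {Ω : Type*} [MeasurableSpace Ω] {P : Measure Ω} {X Y : Ω → ℝ}
    (h : IndepFun X Y P) (hX : Measurable X) (hY : Measurable Y) (s : ℝ) :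
    laplace P (X + Y) s = laplace P X s * laplace P Y s := by
  have hmgf : ∀ Z : Ω → ℝ, laplace P Z s = mgf Z P (-s) := fun Z => by
    simp only [laplace, mgf, neg_mul]
  rw [hmgf, hmgf, hmgf, h.mgf_add (by fun_prop) (by fun_prop)]

theorem integral_comp_radius {Ω E : Type*} [MeasurableSpace Ω] [MeasurableSpace E] {P : Measure Ω}
    [IsFiniteMeasure P] {rad : Ω → ℝ} {Y : Ω → E} (hrad : Measurable rad) (hY : Measurable Y)
    (hind : IndepFun rad Y P) {f : ℝ → ℝ} (hf : Measurable f) (hf_nonneg : ∀ r, 0 ≤ f r)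
    (hlaw : HasLaw rad (volume.withDensity fun r => ENNReal.ofReal (f r)) P) {a : ℝ}
    (hf_zero : ∀ r, r < a → f r = 0) {g : ℝ × E → ℝ} (hg : Measurable g) {C : ℝ}
    (hC : ∀ q, |g q| ≤ C) {Φ : ℝ → ℝ} (hΦ : ∀ d, a < d → ∫ ω, g (d, Y ω) ∂P = Φ d) :
    ∫ ω, g (rad ω, Y ω) ∂P = ∫ r in Ioi a, Φ r * f r := by
  have hsection : ∀ d, ∫ y, g (d, y) ∂P.map Y = ∫ ω, g (d, Y ω) ∂P := fun d =>
    integral_map hY.aemeasurable (hg.comp measurable_prodMk_left).aestronglyMeasurable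
  rw [← integral_map (φ := fun ω => (rad ω, Y ω)) (hrad.prodMk hY).aemeasurable
    hg.aestronglyMeasurable, hind.map_prod_eq_prod_map_map hrad.aemeasurable hY.aemeasurable,
    integral_prod _ (Integrable.of_bound hg.aestronglyMeasurable C (ae_of_all _ hC))]
  simp_rw [hsection]
  rw [hlaw.map_eq, integral_withDensity_eq_integral_toReal_smul hf.ennreal_ofReal (by simp),
    ← integral_Ici_eq_integral_Ioi, ← integral_indicator measurableSet_Ici]
  refine integral_congr_ae ?_
  filter_upwards [Measure.ae_ne volume a] with r hr
  simp only [indicator, mem_Ici, smul_eq_mul]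
  rw [ENNReal.toReal_ofReal (hf_nonneg r)]
  split_ifs with h
  · rw [hΦ r (lt_of_le_of_ne h hr.symm), mul_comm]
  · rw [hf_zero r (not_le.1 h), zero_mul]

theorem abs_exp_neg_mul_le_one {s x : ℝ} (hs : 0 ≤ s) (hx : 0 ≤ x) :
    |Real.exp (-(s * x))| ≤ 1 := by
  rw [Real.abs_exp]
  exact Real.exp_le_one_iff.2 (neg_nonpos.2 (mul_nonneg hs hx))

end Radius

namespace Network

variable {K : ℕ} {Ω : Type*} {M : Network K Ω} {p : Params} {R : Fin (K + 1) → ℝ}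

/-- The target-reflected interference, as a measurable function of the sources of randomness; it
agrees with `IT` where the marks are nonnegative. -/
def targetInterf (M : Network K Ω) (p : Params) (R : Fin (K + 1) → ℝ) (ω : Ω) : ℝ :=
  p.interfAt (R 0) .target (M.radT ω, M.markedPts .target ω)

/-- The co-channel interference, as a measurable function of the sources of randomness; it agrees
with `ILS + INS` where the marks are nonnegative. -/
def directInterf (M : Network K Ω) (p : Params) (R : Fin (K + 1) → ℝ) (ω : Ω) : ℝ :=
  p.interfAt (R 0) .los (M.radI ω, M.markedPts .los ω) +
    p.interfAt (R 0) .nlos (M.radI ω, M.markedPts .nlos ω)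

/-- The total interference and noise, as a measurable function of the sources of randomness; it
agrees with `Itot` where the marks are nonnegative. -/
def totalInterf (M : Network K Ω) (p : Params) (R : Fin (K + 1) → ℝ) (ω : Ω) : ℝ :=
  M.targetInterf p R ω + M.directInterf p R ω + p.noisePower

theorem noisePower_le_totalInterf (hp : p.Valid) (hR : 0 < R 0) (ω : Ω) :
    p.noisePower ≤ M.totalInterf p R ω :=
  le_add_of_nonneg_left (add_nonneg (hp.interfAt_nonneg hR _ _)
    (add_nonneg (hp.interfAt_nonneg hR _ _) (hp.interfAt_nonneg hR _ _)))

theorem measurable_gen_targetInterf {S : Set (Source K)} (hS : targetSources K ⊆ S) :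
    Measurable[M.gen S] (M.targetInterf p R) :=
  (p.measurable_interfAt (R 0) .target).comp (Measurable.prodMk (m := M.gen S)
    (measurable_gen_radT (hS (mem_insert _ _)))
    (measurable_gen_markedPts ((subset_insert _ _).trans hS)))

theorem measurable_gen_directInterf {S : Set (Source K)} (hS : directSources K ⊆ S) :
    Measurable[M.gen S] (M.directInterf p R) := by
  have hradI : Measurable[M.gen S] M.radI := measurable_gen_radI (hS (mem_insert _ _))
  have hsub := (subset_insert _ _).trans hS
  exact Measurable.add (m := M.gen S)
    ((p.measurable_interfAt (R 0) .los).comp (Measurable.prodMk (m := M.gen S) hradI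
      (measurable_gen_markedPts (subset_union_left.trans hsub))))
    ((p.measurable_interfAt (R 0) .nlos).comp (Measurable.prodMk (m := M.gen S) hradI
      (measurable_gen_markedPts (subset_union_right.trans hsub))))

theorem measurable_gen_totalInterf :
    Measurable[M.gen (targetSources K ∪ directSources K)] (M.totalInterf p R) :=
  Measurable.add_const (m := M.gen _) (Measurable.add (m := M.gen _)
    (measurable_gen_targetInterf subset_union_left)
    (measurable_gen_directInterf subset_union_right)) _

namespace IsModel

variable [MeasurableSpace Ω] {P : Measure Ω}

theorem measurable_targetInterf (hM : M.IsModel p R P) : Measurable (M.targetInterf p R) :=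
  (measurable_gen_targetInterf subset_rfl).mono (hM.gen_le _) le_rfl

theorem measurable_directInterf (hM : M.IsModel p R P) : Measurable (M.directInterf p R) :=
  (measurable_gen_directInterf subset_rfl).mono (hM.gen_le _) le_rfl

theorem measurable_totalInterf (hM : M.IsModel p R P) : Measurable (M.totalInterf p R) :=
  measurable_gen_totalInterf.mono (hM.gen_le _) le_rfl

theorem ae_IT_eq (hM : M.IsModel p R P) : M.IT p R =ᵐ[P] M.targetInterf p R := by
  filter_upwards [hM.ae_mark_nonneg] with ω hω
  exact interf_eq_interfAt (hω _) _

theorem ae_ILS_add_INS_eq (hM : M.IsModel p R P) :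
    (fun ω => M.ILS p R ω + M.INS p R ω) =ᵐ[P] M.directInterf p R := by
  filter_upwards [hM.ae_mark_nonneg] with ω hω
  exact congrArg₂ _ (interf_eq_interfAt (hω _) _) (interf_eq_interfAt (hω _) _)

theorem ae_Itot_eq (hM : M.IsModel p R P) : M.Itot p R =ᵐ[P] M.totalInterf p R := by
  filter_upwards [hM.ae_IT_eq, hM.ae_ILS_add_INS_eq] with ω hIT hdirect
  rw [Itot, hIT, totalInterf, ← hdirect, Params.noisePower]
  ring

theorem laplace_interf (hM : M.IsModel p R P) (hp : p.Valid) (hR : 0 < R 0) (j : Kind) {s d : ℝ}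
    (hs : 0 ≤ s) (hd : 0 < d) :
    laplace P (M.interf p R j d) s = Real.exp (-p.lapExponent (R 0) j s d) := by
  rw [← hM.laplace_interfAt hp hR j hs hd]
  exact laplace_congr_ae (hM.ae_mark_nonneg.mono fun ω hω => interf_eq_interfAt (hω j) d) s

theorem laplace_targetInterf (hM : M.IsModel p R P) (hp : p.Valid) (hR : 0 < R 0) {s : ℝ}
    (hs : 0 ≤ s) : laplace P (M.targetInterf p R) s = p.ltTarget K (R 0) s := by
  have := hM.isProbabilityMeasure hp
  have hind : IndepFun M.radT (M.markedPts .target) P :=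
    hM.indepFun (S := {.radT}) (T := markedSources K .target)
      (disjoint_singleton_left.2 (by simp [markedSources])) (measurable_gen_radT rfl)
      (measurable_gen_markedPts subset_rfl)
  have hmeas := p.measurable_interfAt (R 0) .target
  refine integral_comp_radius hM.measurable_radT (hM.measurable_markedPts _) hind
    (p.measurable_densRT K (R 0)) (hp.densRT_nonneg K hR) hM.law_radT
    (fun r hr => by simp [Params.densRT, hr])
    (g := fun q => Real.exp (-(s * p.interfAt (R 0) .target q))) (by fun_prop)
    (abs_exp_neg_mul_le_one hs <| hp.interfAt_nonneg hR _ ·) fun d hd => ?_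
  rw [← p.lapExponent_target _ s (hR.trans hd)]
  exact hM.laplace_interfAt hp hR _ hs (hR.trans hd)

theorem laplace_interfAt_los_add_nlos (hM : M.IsModel p R P) (hp : p.Valid) (hR : 0 < R 0)
    {s d : ℝ} (hs : 0 ≤ s) (hd : 0 < d) :
    laplace P ((fun ω => p.interfAt (R 0) .los (d, M.markedPts .los ω)) +
        fun ω => p.interfAt (R 0) .nlos (d, M.markedPts .nlos ω)) s =
      Real.exp (-(p.xi * (p.JL s d + p.JN s d))) := by
  have hind : IndepFun (M.markedPts .los) (M.markedPts .nlos) P :=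
    hM.indepFun disjoint_markedSources (measurable_gen_markedPts subset_rfl)
      (measurable_gen_markedPts subset_rfl)
  have hmeas : ∀ j, Measurable fun a => p.interfAt (R 0) j (d, a) := fun j =>
    (p.measurable_interfAt (R 0) j).comp measurable_prodMk_left
  refine (laplace_add_of_indepFun (hind.comp (hmeas .los) (hmeas .nlos))
    ((hmeas .los).comp (hM.measurable_markedPts _))
    ((hmeas .nlos).comp (hM.measurable_markedPts _)) s).trans ?_
  simp only [Function.comp_def]
  rw [hM.laplace_interfAt hp hR _ hs hd, hM.laplace_interfAt hp hR _ hs hd, p.lapExponent_los,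
    p.lapExponent_nlos, ← Real.exp_add, mul_add, neg_add]

theorem laplace_directInterf (hM : M.IsModel p R P) (hp : p.Valid) (hR : 0 < R 0) {s : ℝ}
    (hs : 0 ≤ s) : laplace P (M.directInterf p R) s = p.ltDirect s := by
  have := hM.isProbabilityMeasure hp
  have hind : IndepFun M.radI (fun ω => (M.markedPts .los ω, M.markedPts .nlos ω)) P :=
    hM.indepFun (S := {.radI}) (T := markedSources K .los ∪ markedSources K .nlos)
      (disjoint_singleton_left.2 (by simp [markedSources])) (measurable_gen_radI rfl)
      (Measurable.prodMk (m := M.gen _) (measurable_gen_markedPts subset_union_left)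
        (measurable_gen_markedPts subset_union_right))
  have hlos := p.measurable_interfAt (R 0) .los
  have hnlos := p.measurable_interfAt (R 0) .nlos
  exact integral_comp_radius hM.measurable_radI
    ((hM.measurable_markedPts _).prodMk (hM.measurable_markedPts _)) hind
    p.measurable_densRI hp.densRI_nonneg hM.law_radI
    (fun r hr => by simp [Params.densRI, hr.le])
    (g := fun q => Real.exp (-(s * (p.interfAt (R 0) .los (q.1, q.2.1) +
      p.interfAt (R 0) .nlos (q.1, q.2.2))))) (by fun_prop)
    (fun q => abs_exp_neg_mul_le_one hs
      (add_nonneg (hp.interfAt_nonneg hR _ _) (hp.interfAt_nonneg hR _ _)))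
    fun d hd => hM.laplace_interfAt_los_add_nlos hp hR hs hd

theorem laplace_IT (hM : M.IsModel p R P) (hp : p.Valid) (hR : 0 < R 0) {s : ℝ} (hs : 0 ≤ s) :
    laplace P (M.IT p R) s = p.ltTarget K (R 0) s :=
  (laplace_congr_ae hM.ae_IT_eq s).trans (hM.laplace_targetInterf hp hR hs)

theorem laplace_ILS_add_INS (hM : M.IsModel p R P) (hp : p.Valid) (hR : 0 < R 0) {s : ℝ}
    (hs : 0 ≤ s) : laplace P (fun ω => M.ILS p R ω + M.INS p R ω) s = p.ltDirect s :=
  (laplace_congr_ae hM.ae_ILS_add_INS_eq s).trans (hM.laplace_directInterf hp hR hs)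

theorem laplace_totalInterf (hM : M.IsModel p R P) (hp : p.Valid) (hR : 0 < R 0) {s : ℝ}
    (hs : 0 ≤ s) : laplace P (M.totalInterf p R) s =
      p.ltTarget K (R 0) s * p.ltDirect s * Real.exp (-(s * p.noisePower)) := by
  have hind : IndepFun (M.targetInterf p R) (M.directInterf p R) P :=
    hM.indepFun disjoint_targetSources_directSources (measurable_gen_targetInterf subset_rfl)
      (measurable_gen_directInterf subset_rfl)
  rw [← hM.laplace_targetInterf hp hR hs, ← hM.laplace_directInterf hp hR hs,
    ← laplace_add_of_indepFun hind hM.measurable_targetInterf hM.measurable_directInterf, laplace,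
    laplace, ← integral_mul_const]
  simp only [totalInterf, mul_add, neg_add, Real.exp_add, Pi.add_apply]

end IsModel

end Network

/-! ### Moments of the echo power -/

section ExpMeasure

variable {Ω : Type*} [MeasurableSpace Ω] {P : Measure Ω} {X : Ω → ℝ} {σ : ℝ}

theorem memLp_two_of_hasLaw_expMeasure (hσ : 0 < σ) (h : HasLaw X (expMeasure (1 / σ)) P) :
    MemLp X 2 P := by
  have hid := memLp_id_gammaMeasure one_pos (one_div_pos.2 hσ)
  rw [← expMeasure, ← h.map_eq] at hid
  exact hid.comp_of_map h.aemeasurable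

theorem integral_of_hasLaw_expMeasure (hσ : 0 < σ) (h : HasLaw X (expMeasure (1 / σ)) P) :
    ∫ ω, X ω ∂P = σ := by
  rw [h.integral_eq, expMeasure, integral_id_gammaMeasure one_pos (one_div_pos.2 hσ),
    one_div_one_div]

theorem variance_of_hasLaw_expMeasure (hσ : 0 < σ) (h : HasLaw X (expMeasure (1 / σ)) P) :
    variance X P = σ ^ 2 := by
  rw [h.variance_eq, expMeasure, variance_id_gammaMeasure one_pos (one_div_pos.2 hσ)]
  simp

theorem integral_sq_of_hasLaw_expMeasure (hσ : 0 < σ) (h : HasLaw X (expMeasure (1 / σ)) P) :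
    ∫ ω, X ω ^ 2 ∂P = 2 * σ ^ 2 := by
  have := isProbabilityMeasure_expMeasure (one_div_pos.2 hσ)
  have := h.isProbabilityMeasure
  have hvar := variance_eq_sub (memLp_two_of_hasLaw_expMeasure hσ h)
  rw [variance_of_hasLaw_expMeasure hσ h, integral_of_hasLaw_expMeasure hσ h] at hvar
  simp only [Pi.pow_apply] at hvar
  linarith

end ExpMeasure

namespace Params.Valid

variable {p : Params} {R₁ R : ℝ}

theorem muMono_pos (hp : p.Valid) (hR₁ : 0 < R₁) : 0 < p.muMono R₁ := by
  have := hp.Ps_pos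
  have := hp.Gm_pos
  have := hp.wl_pos
  have := hp.rcsMono_pos
  unfold muMono echoMono
  positivity

theorem muBi_pos (hp : p.Valid) (hR₁ : 0 < R₁) (hR : 0 < R) : 0 < p.muBi R₁ R := by
  have := hp.Ps_pos
  have := hp.Gm_pos
  have := hp.wl_pos
  have := hp.rcsBi_pos
  unfold muBi echoBi
  positivity

end Params.Valid

namespace Network

variable {K : ℕ} {Ω : Type*} {M : Network K Ω} {p : Params} {R : Fin (K + 1) → ℝ}

/-- The echo power received through a candidate cooperating BS. -/
def bistaticEcho (M : Network K Ω) (p : Params) (R : Fin (K + 1) → ℝ) (n : Fin K) : Ω → ℝ :=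
  (M.lit n).indicator fun ω => p.echoBi (R 0) (R n.succ) * M.rcsBi n ω

theorem Ptot_eq (M : Network K Ω) (p : Params) (R : Fin (K + 1) → ℝ) :
    M.Ptot p R = (fun ω => p.echoMono (R 0) * M.rcsMono ω) + ∑ n, M.bistaticEcho p R n := by
  ext ω
  simp [Ptot, bistaticEcho]

theorem measurable_gen_bistaticEcho {S : Set (Source K)} {n : Fin K} (hbi : .bi n ∈ S)
    (hlit : .lit n ∈ S) : Measurable[M.gen S] (M.bistaticEcho p R n) :=
  Measurable.indicator (Measurable.const_mul (m := M.gen S) (measurable_gen_rcsBi hbi) _)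
    (measurableSet_gen_lit hlit)

theorem measurable_gen_sum_bistaticEcho {S : Set (Source K)} (hbi : ∀ n, .bi n ∈ S)
    (hlit : ∀ n, .lit n ∈ S) : Measurable[M.gen S] (∑ n, M.bistaticEcho p R n) := by
  rw [Finset.sum_fn]
  exact Finset.measurable_sum (m := M.gen S) _ fun n _ =>
    measurable_gen_bistaticEcho (hbi n) (hlit n)

theorem measurable_gen_Ptot : Measurable[M.gen (echoSources K)] (M.Ptot p R) := by
  rw [Ptot_eq]
  exact Measurable.add (m := M.gen _)
    (Measurable.const_mul (m := M.gen _) (measurable_gen_rcsMono (Or.inl rfl)) _)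
    (measurable_gen_sum_bistaticEcho (fun n => Or.inr (Or.inl ⟨n, rfl⟩))
      fun n => Or.inr (Or.inr ⟨n, rfl⟩))

namespace IsModel

variable [MeasurableSpace Ω] {P : Measure Ω}

theorem measurable_Ptot (hM : M.IsModel p R P) : Measurable (M.Ptot p R) :=
  measurable_gen_Ptot.mono (hM.gen_le _) le_rfl

theorem memLp_rcsMono (hM : M.IsModel p R P) (hp : p.Valid) : MemLp M.rcsMono 2 P :=
  memLp_two_of_hasLaw_expMeasure hp.rcsMono_pos hM.law_rcsMono

theorem memLp_bistaticEcho (hM : M.IsModel p R P) (hp : p.Valid) (n : Fin K) :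
    MemLp (M.bistaticEcho p R n) 2 P :=
  ((memLp_two_of_hasLaw_expMeasure hp.rcsBi_pos (hM.law_rcsBi n)).const_mul _).indicator
    (hM.measurable_lit n)

theorem memLp_Ptot (hM : M.IsModel p R P) (hp : p.Valid) : MemLp (M.Ptot p R) 2 P := by
  rw [Ptot_eq]
  exact ((hM.memLp_rcsMono hp).const_mul _).add
    (memLp_finsetSum' _ fun n _ => hM.memLp_bistaticEcho hp n)

theorem indepFun_rcsMono_sum_bistaticEcho (hM : M.IsModel p R P) :
    IndepFun (fun ω => p.echoMono (R 0) * M.rcsMono ω) (∑ n, M.bistaticEcho p R n) P :=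
  hM.indepFun (S := {.mono}) (T := {i | (∃ n, i = .bi n) ∨ ∃ n, i = .lit n})
    (disjoint_singleton_left.2 (by simp))
    ((measurable_const_mul _).comp (measurable_gen_rcsMono (mem_singleton _)))
    (measurable_gen_sum_bistaticEcho (fun n => Or.inl ⟨n, rfl⟩) fun n => Or.inr ⟨n, rfl⟩)

theorem indepFun_bistaticEcho (hM : M.IsModel p R P) {m n : Fin K} (hmn : m ≠ n) :
    IndepFun (M.bistaticEcho p R m) (M.bistaticEcho p R n) P := by
  have hdisj : Disjoint ({.bi m, .lit m} : Set (Source K)) {.bi n, .lit n} := by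
    rw [Set.disjoint_left]
    rintro i (rfl | rfl) <;> simp [hmn]
  exact hM.indepFun hdisj (measurable_gen_bistaticEcho (Or.inl rfl) (Or.inr rfl))
    (measurable_gen_bistaticEcho (Or.inl rfl) (Or.inr rfl))

theorem setIntegral_lit (hM : M.IsModel p R P) (n : Fin K) {f : ℝ → ℝ} (hf : Measurable f) :
    ∫ ω in M.lit n, f (M.rcsBi n ω) ∂P = p.pLit (R n.succ) * ∫ ω, f (M.rcsBi n ω) ∂P := by
  have hind := hM.indep.indep (i := .lit n) (j := .bi n) (by simp)
  rw [hind.setIntegral_eq_smul (hM.sigma_le _) (hM.measurable_rcsBi n).aemeasurable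
    (MeasurableSpace.measurableSet_generateFrom rfl) hf.aestronglyMeasurable, hM.prob_lit n,
    smul_eq_mul]

theorem integral_bistaticEcho (hM : M.IsModel p R P) (hp : p.Valid) (n : Fin K) :
    ∫ ω, M.bistaticEcho p R n ω ∂P = p.pLit (R n.succ) * p.muBi (R 0) (R n.succ) := by
  unfold bistaticEcho
  rw [integral_indicator (hM.measurable_lit n), integral_const_mul,
    hM.setIntegral_lit n measurable_id',
    integral_of_hasLaw_expMeasure hp.rcsBi_pos (hM.law_rcsBi n), Params.muBi, mul_left_comm]

theorem integral_bistaticEcho_sq (hM : M.IsModel p R P) (hp : p.Valid) (n : Fin K) :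
    ∫ ω, M.bistaticEcho p R n ω ^ 2 ∂P =
      p.pLit (R n.succ) * (2 * p.muBi (R 0) (R n.succ) ^ 2) := by
  have hsq : (fun ω => M.bistaticEcho p R n ω ^ 2) = (M.lit n).indicator fun ω =>
      p.echoBi (R 0) (R n.succ) ^ 2 * M.rcsBi n ω ^ 2 := by
    ext ω
    simp only [bistaticEcho, indicator]
    split_ifs <;> ring
  rw [hsq, integral_indicator (hM.measurable_lit n), integral_const_mul,
    hM.setIntegral_lit n (f := fun x => x ^ 2) (by fun_prop),
    integral_sq_of_hasLaw_expMeasure hp.rcsBi_pos (hM.law_rcsBi n), Params.muBi]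
  ring

theorem integral_Ptot (hM : M.IsModel p R P) (hp : p.Valid) :
    ∫ ω, M.Ptot p R ω ∂P =
      p.muMono (R 0) + ∑ n : Fin K, p.pLit (R n.succ) * p.muBi (R 0) (R n.succ) := by
  have := hM.isProbabilityMeasure hp
  have hecho : ∀ n, Integrable (M.bistaticEcho p R n) P := fun n =>
    (hM.memLp_bistaticEcho hp n).integrable one_le_two
  rw [Ptot_eq, integral_add' (((hM.memLp_rcsMono hp).integrable one_le_two).const_mul _)
    (integrable_finsetSum' _ fun n _ => hecho n), integral_const_mul,
    integral_of_hasLaw_expMeasure hp.rcsMono_pos hM.law_rcsMono]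
  simp only [Finset.sum_apply]
  rw [integral_finsetSum _ fun n _ => hecho n]
  simp only [hM.integral_bistaticEcho hp, Params.muMono]

theorem variance_bistaticEcho (hM : M.IsModel p R P) (hp : p.Valid) (n : Fin K) :
    variance (M.bistaticEcho p R n) P = p.pLit (R n.succ) * (2 - p.pLit (R n.succ)) *
      p.muBi (R 0) (R n.succ) ^ 2 := by
  have := hM.isProbabilityMeasure hp
  rw [variance_eq_sub (hM.memLp_bistaticEcho hp n), hM.integral_bistaticEcho hp]
  simp only [Pi.pow_apply]
  rw [hM.integral_bistaticEcho_sq hp]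
  ring

theorem variance_Ptot (hM : M.IsModel p R P) (hp : p.Valid) :
    variance (M.Ptot p R) P = p.muMono (R 0) ^ 2 +
      ∑ n : Fin K, p.pLit (R n.succ) * (2 - p.pLit (R n.succ)) * p.muBi (R 0) (R n.succ) ^ 2 := by
  have := hM.isProbabilityMeasure hp
  rw [Ptot_eq, hM.indepFun_rcsMono_sum_bistaticEcho.variance_add
    ((hM.memLp_rcsMono hp).const_mul _) (memLp_finsetSum' _ fun n _ => hM.memLp_bistaticEcho hp n),
    IndepFun.variance_sum (fun n _ => hM.memLp_bistaticEcho hp n)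
      fun m _ n _ hmn => hM.indepFun_bistaticEcho hmn,
    variance_const_mul, variance_of_hasLaw_expMeasure hp.rcsMono_pos hM.law_rcsMono, ← mul_pow,
    ← Params.muMono]
  simp only [hM.variance_bistaticEcho hp]

theorem integral_Ptot_pos (hM : M.IsModel p R P) (hp : p.Valid) (hR : ∀ n, 0 < R n) :
    0 < ∫ ω, M.Ptot p R ω ∂P := by
  rw [hM.integral_Ptot hp]
  refine add_pos_of_pos_of_nonneg (hp.muMono_pos (hR 0)) (Finset.sum_nonneg fun n _ => ?_)
  exact mul_nonneg (hM.prob_lit n ▸ measureReal_nonneg) (hp.muBi_pos (hR 0) (hR _)).le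

theorem variance_Ptot_pos (hM : M.IsModel p R P) (hp : p.Valid) (hR : 0 < R 0) :
    0 < variance (M.Ptot p R) P := by
  have := hM.isProbabilityMeasure hp
  rw [hM.variance_Ptot hp]
  refine add_pos_of_pos_of_nonneg (pow_pos (hp.muMono_pos hR) 2)
    (Finset.sum_nonneg fun n _ => ?_)
  have hnonneg : 0 ≤ p.pLit (R n.succ) := hM.prob_lit n ▸ measureReal_nonneg
  have hle_one : p.pLit (R n.succ) ≤ 1 := hM.prob_lit n ▸ measureReal_le_one
  exact mul_nonneg (mul_nonneg hnonneg (by linarith)) (sq_nonneg _)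

theorem kEff_pos (hM : M.IsModel p R P) (hp : p.Valid) (hR : ∀ n, 0 < R n) :
    0 < M.kEff p R P :=
  div_pos (pow_pos (hM.integral_Ptot_pos hp hR) 2) (hM.variance_Ptot_pos hp (hR 0))

theorem thetaEff_pos (hM : M.IsModel p R P) (hp : p.Valid) (hR : ∀ n, 0 < R n) :
    0 < M.thetaEff p R P :=
  div_pos (hM.variance_Ptot_pos hp (hR 0)) (hM.integral_Ptot_pos hp hR)

theorem isProbabilityMeasure_gammaLaw (hM : M.IsModel p R P) (hp : p.Valid)
    (hR : ∀ n, 0 < R n) : IsProbabilityMeasure (M.gammaLaw p R P) :=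
  isProbabilityMeasure_gammaMeasure (hM.kEff_pos hp hR) (inv_pos.2 (hM.thetaEff_pos hp hR))

theorem integral_gammaLaw (hM : M.IsModel p R P) (hp : p.Valid) (hR : ∀ n, 0 < R n) :
    ∫ x, x ∂(M.gammaLaw p R P) = ∫ ω, M.Ptot p R ω ∂P := by
  have := hM.integral_Ptot_pos hp hR
  have := hM.variance_Ptot_pos hp (hR 0)
  rw [gammaLaw, integral_id_gammaMeasure (hM.kEff_pos hp hR) (inv_pos.2 (hM.thetaEff_pos hp hR)),
    kEff, thetaEff]
  field_simp

theorem variance_gammaLaw (hM : M.IsModel p R P) (hp : p.Valid) (hR : ∀ n, 0 < R n) :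
    variance id (M.gammaLaw p R P) = variance (M.Ptot p R) P := by
  have := hM.integral_Ptot_pos hp hR
  have := hM.variance_Ptot_pos hp (hR 0)
  rw [gammaLaw, variance_id_gammaMeasure (hM.kEff_pos hp hR) (inv_pos.2 (hM.thetaEff_pos hp hR)),
    kEff, thetaEff]
  field_simp

end IsModel

end Network

/-! ### Coverage probabilities -/

section Tail

theorem measureReal_prod_lt (μ : Measure ℝ) [IsFiniteMeasure μ] {E : Type*} [MeasurableSpace E]
    (ν : Measure E) [IsFiniteMeasure ν] {h : E → ℝ} (hh : AEMeasurable h ν) :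
    (μ.prod ν).real {q | h q.2 < q.1} = ∫ e, μ.real (Ioi (h e)) ∂ν := by
  have hset : {q : ℝ × E | h q.2 < q.1} =ᵐ[μ.prod ν] {q | hh.mk h q.2 < q.1} := by
    filter_upwards [Measure.quasiMeasurePreserving_snd.ae hh.ae_eq_mk] with q hq
    exact propext (by change h q.2 < q.1 ↔ hh.mk h q.2 < q.1; rw [hq])
  have hmeas : MeasurableSet {q : ℝ × E | hh.mk h q.2 < q.1} :=
    measurableSet_lt (hh.measurable_mk.comp measurable_snd) measurable_fst
  rw [measureReal_congr hset, measureReal_def, Measure.prod_apply_symm hmeas, ← integral_toReal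
    (measurable_measure_prodMk_right hmeas).aemeasurable (ae_of_all _ fun _ => measure_lt_top _ _)]
  refine integral_congr_ae ?_
  filter_upwards [hh.ae_eq_mk] with e he
  rw [he]
  rfl

theorem measureReal_lt_of_indepFun {Ω : Type*} [MeasurableSpace Ω] {P : Measure Ω}
    [IsFiniteMeasure P] {X Y : Ω → ℝ} (h : IndepFun X Y P) (hX : AEMeasurable X P)
    (hY : AEMeasurable Y P) :
    P.real {ω | Y ω < X ω} = ∫ ω, P.real {ω' | Y ω < X ω'} ∂P := by
  have hlt : MeasurableSet {q : ℝ × ℝ | q.2 < q.1} := measurableSet_lt measurable_snd measurable_fst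
  have htail : ∀ y, P.real {ω | y < X ω} = (P.map X).real (Ioi y) := fun y =>
    (map_measureReal_apply_of_aemeasurable hX measurableSet_Ioi).symm
  calc P.real {ω | Y ω < X ω} = (P.map fun ω => (X ω, Y ω)).real {q | q.2 < q.1} :=
        (map_measureReal_apply_of_aemeasurable (hX.prodMk hY) hlt).symm
    _ = ((P.map X).prod (P.map Y)).real {q | q.2 < q.1} := by
        rw [h.map_prod_eq_prod_map_map hX hY]
    _ = ∫ y, (P.map X).real (Ioi y) ∂P.map Y := measureReal_prod_lt _ _ aemeasurable_id
    _ = ∫ ω, (P.map X).real (Ioi (Y ω)) ∂P := by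
        have hanti : Antitone fun y => (P.map X).real (Ioi y) := fun _ _ hxy =>
          measureReal_mono (Ioi_subset_Ioi hxy)
        exact integral_map hY hanti.measurable.aestronglyMeasurable
    _ = ∫ ω, P.real {ω' | Y ω < X ω'} ∂P := by simp_rw [htail]

theorem antitone_measureReal_lt {E : Type*} [MeasurableSpace E] (μ : Measure E) [IsFiniteMeasure μ]
    (X : E → ℝ) : Antitone fun x => μ.real {e | x < X e} :=
  fun _ _ hxy => measureReal_mono fun _ he => lt_of_le_of_lt hxy he

end Tail

namespace Network

variable {K : ℕ} {Ω : Type*} [MeasurableSpace Ω] {M : Network K Ω} {p : Params}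
  {R : Fin (K + 1) → ℝ} {P : Measure Ω}

theorem alzer_eq (M : Network K Ω) (p : Params) (R : Fin (K + 1) → ℝ) (P : Measure Ω) (x : ℝ) :
    M.alzer p R P x =
      1 - (1 - Real.exp (-(alzerRate (M.kEff p R P) (M.thetaEff p R P)⁻¹ * x))) ^
        M.kEff p R P := by
  rw [alzer, alzerRate, eta, div_eq_mul_inv, mul_right_comm]

theorem measurable_alzer (M : Network K Ω) (p : Params) (R : Fin (K + 1) → ℝ) (P : Measure Ω) :
    Measurable (M.alzer p R P) := by
  unfold alzer
  fun_prop

theorem sArg_mul (M : Network K Ω) (p : Params) (R : Fin (K + 1) → ℝ) (P : Measure Ω)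
    (τ x : ℝ) (z : ℕ+) : M.sArg p R P τ z * x =
      z * (alzerRate (M.kEff p R P) (M.thetaEff p R P)⁻¹ * (τ * x)) := by
  rw [sArg, alzerRate, eta, div_eq_mul_inv]
  ring

namespace IsModel

theorem aemeasurable_Itot (hM : M.IsModel p R P) : AEMeasurable (M.Itot p R) P :=
  ⟨_, hM.measurable_totalInterf, hM.ae_Itot_eq⟩

theorem ae_Itot_pos (hM : M.IsModel p R P) (hp : p.Valid) (hR : 0 < R 0) :
    ∀ᵐ ω ∂P, 0 < M.Itot p R ω := by
  filter_upwards [hM.ae_Itot_eq] with ω hω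
  exact hω ▸ hp.noisePower_pos.trans_le (noisePower_le_totalInterf hp hR ω)

theorem ae_lt_div_Itot_iff (hM : M.IsModel p R P) (hp : p.Valid) (hR : 0 < R 0) (τ : ℝ) :
    ∀ᵐ ω ∂P, ∀ x, τ < x / M.Itot p R ω ↔ τ * M.Itot p R ω < x := by
  filter_upwards [hM.ae_Itot_pos hp hR] with ω hω x using lt_div_iff₀ hω

theorem indepFun_Ptot_Itot (hM : M.IsModel p R P) : IndepFun (M.Ptot p R) (M.Itot p R) P :=
  (hM.indepFun disjoint_echoSources measurable_gen_Ptot measurable_gen_totalInterf).congr .rfl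
    hM.ae_Itot_eq.symm

theorem coverage_eq (hM : M.IsModel p R P) (hp : p.Valid) (hR : 0 < R 0) (τ : ℝ) :
    M.coverage p R P τ = ∫ ω, P.real {ω' | τ * M.Itot p R ω < M.Ptot p R ω'} ∂P := by
  have := hM.isProbabilityMeasure hp
  have hindep : IndepFun (M.Ptot p R) (fun ω => τ * M.Itot p R ω) P :=
    hM.indepFun_Ptot_Itot.comp measurable_id (measurable_const_mul τ)
  rw [← measureReal_lt_of_indepFun hindep hM.measurable_Ptot.aemeasurable
    (hM.aemeasurable_Itot.const_mul τ)]
  refine measureReal_congr ?_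
  filter_upwards [hM.ae_lt_div_Itot_iff hp hR τ] with ω hω using propext (hω _)

theorem gammaCoverage_eq (hM : M.IsModel p R P) (hp : p.Valid) (hR : ∀ n, 0 < R n) (τ : ℝ) :
    M.gammaCoverage p R P τ = ∫ ω, (M.gammaLaw p R P).real (Ioi (τ * M.Itot p R ω)) ∂P := by
  have := hM.isProbabilityMeasure hp
  have := hM.isProbabilityMeasure_gammaLaw hp hR
  rw [← measureReal_prod_lt _ _ (hM.aemeasurable_Itot.const_mul τ)]
  refine measureReal_congr ?_
  filter_upwards [Measure.quasiMeasurePreserving_snd.ae (hM.ae_lt_div_Itot_iff hp (hR 0) τ)]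
    with q hq using propext (hq _)

theorem integrable_comp_Itot (hM : M.IsModel p R P) (hp : p.Valid) (hR : 0 < R 0) {τ : ℝ}
    (hτ : 0 < τ) {f : ℝ → ℝ} (hf : Measurable f) {C : ℝ} (hC : ∀ x, 0 ≤ x → |f x| ≤ C) :
    Integrable (fun ω => f (τ * M.Itot p R ω)) P := by
  have := hM.isProbabilityMeasure hp
  refine Integrable.of_bound
    (hf.comp_aemeasurable (hM.aemeasurable_Itot.const_mul τ)).aestronglyMeasurable C ?_
  filter_upwards [hM.ae_Itot_pos hp hR] with ω hω
  exact hC _ (by positivity)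

theorem integrable_tail (hM : M.IsModel p R P) (hp : p.Valid) (hR : 0 < R 0) {τ : ℝ}
    (hτ : 0 < τ) {E : Type*} [MeasurableSpace E] (μ : Measure E) [IsProbabilityMeasure μ]
    (X : E → ℝ) : Integrable (fun ω => μ.real {e | τ * M.Itot p R ω < X e}) P :=
  hM.integrable_comp_Itot hp hR hτ (antitone_measureReal_lt μ X).measurable (C := 1)
    fun _ _ => by rw [abs_of_nonneg measureReal_nonneg]; exact measureReal_le_one

theorem integrable_gammaLaw_tail (hM : M.IsModel p R P) (hp : p.Valid) (hR : ∀ n, 0 < R n)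
    {τ : ℝ} (hτ : 0 < τ) :
    Integrable (fun ω => (M.gammaLaw p R P).real (Ioi (τ * M.Itot p R ω))) P :=
  have := hM.isProbabilityMeasure_gammaLaw hp hR
  hM.integrable_tail hp (hR 0) hτ (M.gammaLaw p R P) id

theorem alzerRate_kEff_pos (hM : M.IsModel p R P) (hp : p.Valid) (hR : ∀ n, 0 < R n) :
    0 < alzerRate (M.kEff p R P) (M.thetaEff p R P)⁻¹ :=
  alzerRate_pos (hM.kEff_pos hp hR) (inv_pos.2 (hM.thetaEff_pos hp hR))

theorem gammaLaw_real_Ioi_le_alzer (hM : M.IsModel p R P) (hp : p.Valid) (hR : ∀ n, 0 < R n)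
    (hk : 1 ≤ M.kEff p R P) {x : ℝ} (hx : 0 ≤ x) :
    (M.gammaLaw p R P).real (Ioi x) ≤ M.alzer p R P x := by
  rw [alzer_eq]
  exact gammaMeasure_real_Ioi_le_alzer hk (inv_pos.2 (hM.thetaEff_pos hp hR)) hx

theorem alzer_le_gammaLaw_real_Ioi (hM : M.IsModel p R P) (hp : p.Valid) (hR : ∀ n, 0 < R n)
    (hk : M.kEff p R P ≤ 1) {x : ℝ} (hx : 0 ≤ x) :
    M.alzer p R P x ≤ (M.gammaLaw p R P).real (Ioi x) := by
  rw [alzer_eq]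
  exact alzer_le_gammaMeasure_real_Ioi (hM.kEff_pos hp hR) hk
    (inv_pos.2 (hM.thetaEff_pos hp hR)) hx

theorem abs_alzer_le_one (hM : M.IsModel p R P) (hp : p.Valid) (hR : ∀ n, 0 < R n) {x : ℝ}
    (hx : 0 ≤ x) : |M.alzer p R P x| ≤ 1 := by
  rw [alzer_eq]
  have hrate := hM.alzerRate_kEff_pos hp hR
  set q := Real.exp (-(alzerRate (M.kEff p R P) (M.thetaEff p R P)⁻¹ * x))
  have hq0 : 0 ≤ 1 - q := sub_nonneg.2 (Real.exp_le_one_iff.2 (neg_nonpos.2 (by positivity)))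
  have hq1 : 1 - q ≤ 1 := sub_le_self _ (Real.exp_pos _).le
  have hpow0 : 0 ≤ (1 - q) ^ M.kEff p R P := Real.rpow_nonneg hq0 _
  have hpow1 : (1 - q) ^ M.kEff p R P ≤ 1 := Real.rpow_le_one hq0 hq1 (hM.kEff_pos hp hR).le
  exact abs_le.2 ⟨by linarith, by linarith⟩

theorem integrable_alzer (hM : M.IsModel p R P) (hp : p.Valid) (hR : ∀ n, 0 < R n) {τ : ℝ}
    (hτ : 0 < τ) : Integrable (fun ω => M.alzer p R P (τ * M.Itot p R ω)) P :=
  hM.integrable_comp_Itot hp (hR 0) hτ (M.measurable_alzer p R P) fun _ => hM.abs_alzer_le_one hp hR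

theorem sArg_nonneg (hM : M.IsModel p R P) (hp : p.Valid) (hR : ∀ n, 0 < R n) {τ : ℝ}
    (hτ : 0 < τ) (z : ℕ+) : 0 ≤ M.sArg p R P τ z := by
  have := hM.alzerRate_kEff_pos hp hR
  rw [← mul_one (M.sArg p R P τ z), sArg_mul]
  positivity

theorem hasSum_alzer (hM : M.IsModel p R P) (hp : p.Valid) (hR : ∀ n, 0 < R n) {τ x : ℝ}
    (hτ : 0 < τ) (hx : 0 < x) :
    HasSum (fun z : ℕ+ => Ring.choose (M.kEff p R P) (z : ℕ) * (-1) ^ ((z : ℕ) + 1) *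
      Real.exp (-(M.sArg p R P τ z * x))) (M.alzer p R P (τ * x)) := by
  have hrate := hM.alzerRate_kEff_pos hp hR
  have hpow : ∀ z : ℕ+, Real.exp (-(M.sArg p R P τ z * x)) =
      Real.exp (-(alzerRate (M.kEff p R P) (M.thetaEff p R P)⁻¹ * (τ * x))) ^ (z : ℕ) := fun z => by
    rw [sArg_mul, ← mul_neg, Real.exp_nat_mul]
  simp_rw [alzer_eq, hpow]
  refine hasSum_pnat_choose_mul_pow _ ?_
  rw [Real.abs_exp]
  exact Real.exp_lt_one_iff.2 (neg_lt_zero.2 (by positivity))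

theorem coverageTerm_eq (hM : M.IsModel p R P) (hp : p.Valid) (hR : ∀ n, 0 < R n) {τ : ℝ}
    (hτ : 0 < τ) (z : ℕ+) :
    M.coverageTerm p R P τ z = ∫ ω, Ring.choose (M.kEff p R P) (z : ℕ) * (-1) ^ ((z : ℕ) + 1) *
      Real.exp (-(M.sArg p R P τ z * M.totalInterf p R ω)) ∂P := by
  have hlaplace := hM.laplace_totalInterf hp (hR 0) (hM.sArg_nonneg hp hR hτ z)
  rw [laplace] at hlaplace
  rw [integral_const_mul, hlaplace, coverageTerm, Params.noisePower, mul_add, neg_add,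
    Real.exp_add]
  ring

theorem norm_mul_exp_totalInterf_le (hM : M.IsModel p R P) (hp : p.Valid) (hR : ∀ n, 0 < R n)
    {τ : ℝ} (hτ : 0 < τ) (z : ℕ+) (c : ℝ) (ω : Ω) :
    ‖c * Real.exp (-(M.sArg p R P τ z * M.totalInterf p R ω))‖ ≤
      |c * Real.exp (-(M.sArg p R P τ z * p.noisePower))| := by
  have hs := hM.sArg_nonneg hp hR hτ z
  have hnoise := noisePower_le_totalInterf (M := M) hp (hR 0) ω
  rw [Real.norm_eq_abs, abs_mul, abs_mul, Real.abs_exp, Real.abs_exp]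
  gcongr

theorem hasSum_coverageTerm (hM : M.IsModel p R P) (hp : p.Valid) (hR : ∀ n, 0 < R n) {τ : ℝ}
    (hτ : 0 < τ) :
    HasSum (M.coverageTerm p R P τ) (∫ ω, M.alzer p R P (τ * M.Itot p R ω) ∂P) := by
  have := hM.isProbabilityMeasure hp
  have hmeas := hM.measurable_totalInterf
  -- The noise power bounds the interference from below, so the expansion at the noise power
  -- dominates the series uniformly in `ω`.
  have hbound := (hM.hasSum_alzer hp hR hτ hp.noisePower_pos).summable.abs
  have hsum := hasSum_integral_of_dominated_convergence
    (fun (z : ℕ+) _ => |Ring.choose (M.kEff p R P) (z : ℕ) * (-1) ^ ((z : ℕ) + 1) *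
      Real.exp (-(M.sArg p R P τ z * p.noisePower))|)
    (fun z => Measurable.aestronglyMeasurable (by fun_prop))
    (fun z => ae_of_all _ (hM.norm_mul_exp_totalInterf_le hp hR hτ z _))
    (ae_of_all _ fun _ => hbound) (integrable_const _)
    (ae_of_all P fun ω => hM.hasSum_alzer hp hR hτ
      (hp.noisePower_pos.trans_le (noisePower_le_totalInterf hp (hR 0) ω)))
  rw [integral_congr_ae (hM.ae_Itot_eq.mono fun ω hω => by rw [hω])]
  exact hsum.congr_fun fun z => hM.coverageTerm_eq hp hR hτ z

theorem gammaCoverage_le_tsum_coverageTerm (hM : M.IsModel p R P) (hp : p.Valid)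
    (hR : ∀ n, 0 < R n) {τ : ℝ} (hτ : 0 < τ) (hk : 1 ≤ M.kEff p R P) :
    M.gammaCoverage p R P τ ≤ ∑' z : ℕ+, M.coverageTerm p R P τ z := by
  rw [(hM.hasSum_coverageTerm hp hR hτ).tsum_eq, hM.gammaCoverage_eq hp hR]
  refine integral_mono_ae (hM.integrable_gammaLaw_tail hp hR hτ) (hM.integrable_alzer hp hR hτ) ?_
  filter_upwards [hM.ae_Itot_pos hp (hR 0)] with ω hω
  exact hM.gammaLaw_real_Ioi_le_alzer hp hR hk (mul_pos hτ hω).le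

theorem tsum_coverageTerm_le_gammaCoverage (hM : M.IsModel p R P) (hp : p.Valid)
    (hR : ∀ n, 0 < R n) {τ : ℝ} (hτ : 0 < τ) (hk : M.kEff p R P ≤ 1) :
    ∑' z : ℕ+, M.coverageTerm p R P τ z ≤ M.gammaCoverage p R P τ := by
  rw [(hM.hasSum_coverageTerm hp hR hτ).tsum_eq, hM.gammaCoverage_eq hp hR]
  refine integral_mono_ae (hM.integrable_alzer hp hR hτ) (hM.integrable_gammaLaw_tail hp hR hτ) ?_
  filter_upwards [hM.ae_Itot_pos hp (hR 0)] with ω hω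
  exact hM.alzer_le_gammaLaw_real_Ioi hp hR hk (mul_pos hτ hω).le

theorem abs_coverage_sub_tsum_coverageTerm_le (hM : M.IsModel p R P) (hp : p.Valid)
    (hR : ∀ n, 0 < R n) {τ ε₁ ε₂ : ℝ} (hτ : 0 < τ)
    (h₁ : ∀ x, 0 < x → |P.real {ω | x < M.Ptot p R ω} - (M.gammaLaw p R P).real (Ioi x)| ≤ ε₁)
    (h₂ : ∀ x, 0 < x → |(M.gammaLaw p R P).real (Ioi x) - M.alzer p R P x| ≤ ε₂) :
    |M.coverage p R P τ - ∑' z : ℕ+, M.coverageTerm p R P τ z| ≤ ε₁ + ε₂ := by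
  have := hM.isProbabilityMeasure hp
  rw [(hM.hasSum_coverageTerm hp hR hτ).tsum_eq, hM.coverage_eq hp (hR 0),
    ← integral_sub (hM.integrable_tail hp (hR 0) hτ P _) (hM.integrable_alzer hp hR hτ),
    ← Real.norm_eq_abs]
  refine (norm_integral_le_of_norm_le_const (C := ε₁ + ε₂) ?_).trans_eq (by simp)
  filter_upwards [hM.ae_Itot_pos hp (hR 0)] with ω hω
  exact (abs_sub_le _ _ _).trans (add_le_add (h₁ _ (mul_pos hτ hω)) (h₂ _ (mul_pos hτ hω)))

end IsModel

end Network

end CoopSensing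

end

theorem theorem1_general {Ω : Type*} [MeasurableSpace Ω] (P : MeasureTheory.Measure Ω) (K : ℕ)
    (p : CoopSensing.Params) (hp : p.Valid) (R : Fin (K + 1) → ℝ) (hR : ∀ n, 0 < R n)
    (M : CoopSensing.Network K Ω) (hM : M.IsModel p R P) (τ : ℝ) (hτ : 0 < τ) :
    (∀ᵐ ω ∂P, ∀ j, Summable (M.interfTerm p j (M.radius j ω) ω)) ∧
    MemLp (M.Ptot p R) 2 P ∧
    ∫ ω, M.Ptot p R ω ∂P =
      p.muMono (R 0) + ∑ n : Fin K, p.pLit (R n.succ) * p.muBi (R 0) (R n.succ) ∧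
    variance (M.Ptot p R) P = p.muMono (R 0) ^ 2 +
      ∑ n : Fin K, p.pLit (R n.succ) * (2 - p.pLit (R n.succ)) * p.muBi (R 0) (R n.succ) ^ 2 ∧
    0 < M.kEff p R P ∧ 0 < M.thetaEff p R P ∧
    ∫ x, x ∂(M.gammaLaw p R P) = ∫ ω, M.Ptot p R ω ∂P ∧
    variance id (M.gammaLaw p R P) = variance (M.Ptot p R) P ∧
    (∀ s, 0 ≤ s → CoopSensing.laplace P (M.IT p R) s = p.ltTarget K (R 0) s) ∧
    (∀ s, 0 ≤ s → ∀ d, 0 < d →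
      CoopSensing.laplace P (M.interf p R .los d) s = Real.exp (-(p.xi * p.JL s d)) ∧
      CoopSensing.laplace P (M.interf p R .nlos d) s = Real.exp (-(p.xi * p.JN s d))) ∧
    (∀ s, 0 ≤ s →
      CoopSensing.laplace P (fun ω => M.ILS p R ω + M.INS p R ω) s = p.ltDirect s) ∧
    M.coverage p R P τ = ∫ ω, P.real {ω' | τ * M.Itot p R ω < M.Ptot p R ω'} ∂P ∧
    M.gammaCoverage p R P τ = ∫ ω, (M.gammaLaw p R P).real (Ioi (τ * M.Itot p R ω)) ∂P ∧
    (∀ x, 0 ≤ x →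
      (1 ≤ M.kEff p R P → (M.gammaLaw p R P).real (Ioi x) ≤ M.alzer p R P x) ∧
      (M.kEff p R P ≤ 1 → M.alzer p R P x ≤ (M.gammaLaw p R P).real (Ioi x))) ∧
    (∀ᵐ ω ∂P, HasSum (fun z : ℕ+ => Ring.choose (M.kEff p R P) (z : ℕ) * (-1) ^ ((z : ℕ) + 1) *
        Real.exp (-(M.sArg p R P τ z * M.Itot p R ω))) (M.alzer p R P (τ * M.Itot p R ω))) ∧
    HasSum (M.coverageTerm p R P τ) (∫ ω, M.alzer p R P (τ * M.Itot p R ω) ∂P) ∧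
    (1 ≤ M.kEff p R P → M.gammaCoverage p R P τ ≤ ∑' z : ℕ+, M.coverageTerm p R P τ z) ∧
    (M.kEff p R P ≤ 1 → ∑' z : ℕ+, M.coverageTerm p R P τ z ≤ M.gammaCoverage p R P τ) ∧
    (∀ ε₁ ε₂ : ℝ,
      (∀ x, 0 < x →
        |P.real {ω | x < M.Ptot p R ω} - (M.gammaLaw p R P).real (Ioi x)| ≤ ε₁) →
      (∀ x, 0 < x → |(M.gammaLaw p R P).real (Ioi x) - M.alzer p R P x| ≤ ε₂) →
      |M.coverage p R P τ - ∑' z : ℕ+, M.coverageTerm p R P τ z| ≤ ε₁ + ε₂) := by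
  have hexpansion : ∀ᵐ ω ∂P, HasSum (fun z : ℕ+ => Ring.choose (M.kEff p R P) (z : ℕ) *
      (-1) ^ ((z : ℕ) + 1) * Real.exp (-(M.sArg p R P τ z * M.Itot p R ω)))
      (M.alzer p R P (τ * M.Itot p R ω)) := by
    filter_upwards [hM.ae_Itot_pos hp (hR 0)] with ω hω using hM.hasSum_alzer hp hR hτ hω
  exact ⟨hM.ae_summable_interfTerm hp (hR 0), hM.memLp_Ptot hp, hM.integral_Ptot hp,
    hM.variance_Ptot hp, hM.kEff_pos hp hR, hM.thetaEff_pos hp hR,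
    hM.integral_gammaLaw hp hR, hM.variance_gammaLaw hp hR,
    fun s hs => hM.laplace_IT hp (hR 0) hs,
    fun s hs d hd => ⟨by rw [hM.laplace_interf hp (hR 0) _ hs hd, p.lapExponent_los],
      by rw [hM.laplace_interf hp (hR 0) _ hs hd, p.lapExponent_nlos]⟩,
    fun s hs => hM.laplace_ILS_add_INS hp (hR 0) hs, hM.coverage_eq hp (hR 0) τ,
    hM.gammaCoverage_eq hp hR τ,
    fun x hx => ⟨fun hk => hM.gammaLaw_real_Ioi_le_alzer hp hR hk hx,
      fun hk => hM.alzer_le_gammaLaw_real_Ioi hp hR hk hx⟩,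
    hexpansion, hM.hasSum_coverageTerm hp hR hτ,
    fun hk => hM.gammaCoverage_le_tsum_coverageTerm hp hR hτ hk,
    fun hk => hM.tsum_coverageTerm_le_gammaCoverage hp hR hτ hk,
    fun _ _ h₁ h₂ => hM.abs_coverage_sub_tsum_coverageTerm_le hp hR hτ h₁ h₂⟩

theorem theorem1 {Ω : Type*} [MeasurableSpace Ω] (P : MeasureTheory.Measure Ω)
    [MeasureTheory.IsProbabilityMeasure P] (K : ℕ) (p : CoopSensing.Params) (hp : p.Valid)
    (R : Fin (K + 1) → ℝ) (hR₀ : 0 < R 0) (hR : StrictMono R)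
    (M : CoopSensing.Network K Ω) (hM : M.IsModel p R P) (τ : ℝ) (hτ : 0 < τ) :
    -- the interference sums converge almost surely
    (∀ᵐ ω ∂P, ∀ j, Summable (M.interfTerm p j (M.radius j ω) ω)) ∧
    -- mean and variance of the total echo power
    MemLp (M.Ptot p R) 2 P ∧
    ∫ ω, M.Ptot p R ω ∂P =
      p.muMono (R 0) + ∑ n : Fin K, p.pLit (R n.succ) * p.muBi (R 0) (R n.succ) ∧
    variance (M.Ptot p R) P = p.muMono (R 0) ^ 2 +
      ∑ n : Fin K, p.pLit (R n.succ) * (2 - p.pLit (R n.succ)) * p.muBi (R 0) (R n.succ) ^ 2 ∧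
    -- the Gamma law matches both moments
    0 < M.kEff p R P ∧ 0 < M.thetaEff p R P ∧
    ∫ x, x ∂(M.gammaLaw p R P) = ∫ ω, M.Ptot p R ω ∂P ∧
    variance id (M.gammaLaw p R P) = variance (M.Ptot p R) P ∧
    -- Laplace transforms of the interference
    (∀ s, 0 ≤ s → CoopSensing.laplace P (M.IT p R) s = p.ltTarget K (R 0) s) ∧
    (∀ s, 0 ≤ s → ∀ d, 0 < d →
      CoopSensing.laplace P (M.interf p R .los d) s = Real.exp (-(p.xi * p.JL s d)) ∧
      CoopSensing.laplace P (M.interf p R .nlos d) s = Real.exp (-(p.xi * p.JN s d))) ∧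
    (∀ s, 0 ≤ s →
      CoopSensing.laplace P (fun ω => M.ILS p R ω + M.INS p R ω) s = p.ltDirect s) ∧
    -- the coverage as the average of the tail of the total echo power, and with the Gamma tail
    M.coverage p R P τ = ∫ ω, P.real {ω' | τ * M.Itot p R ω < M.Ptot p R ω'} ∂P ∧
    M.gammaCoverage p R P τ = ∫ ω, (M.gammaLaw p R P).real (Ioi (τ * M.Itot p R ω)) ∂P ∧
    -- Alzer's inequality for the Gamma tail, and the expansion of its right-hand side
    (∀ x, 0 ≤ x →
      (1 ≤ M.kEff p R P → (M.gammaLaw p R P).real (Ioi x) ≤ M.alzer p R P x) ∧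
      (M.kEff p R P ≤ 1 → M.alzer p R P x ≤ (M.gammaLaw p R P).real (Ioi x))) ∧
    (∀ᵐ ω ∂P, HasSum (fun z : ℕ+ => Ring.choose (M.kEff p R P) (z : ℕ) * (-1) ^ ((z : ℕ) + 1) *
        Real.exp (-(M.sArg p R P τ z * M.Itot p R ω))) (M.alzer p R P (τ * M.Itot p R ω))) ∧
    -- the series is the average of Alzer's expression over the interference
    HasSum (M.coverageTerm p R P τ) (∫ ω, M.alzer p R P (τ * M.Itot p R ω) ∂P) ∧
    -- comparison of the series with the coverage for the Gamma law and with the coverage itself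
    (1 ≤ M.kEff p R P → M.gammaCoverage p R P τ ≤ ∑' z : ℕ+, M.coverageTerm p R P τ z) ∧
    (M.kEff p R P ≤ 1 → ∑' z : ℕ+, M.coverageTerm p R P τ z ≤ M.gammaCoverage p R P τ) ∧
    (∀ ε₁ ε₂ : ℝ,
      (∀ x, 0 < x →
        |P.real {ω | x < M.Ptot p R ω} - (M.gammaLaw p R P).real (Ioi x)| ≤ ε₁) →
      (∀ x, 0 < x → |(M.gammaLaw p R P).real (Ioi x) - M.alzer p R P x| ≤ ε₂) →
      |M.coverage p R P τ - ∑' z : ℕ+, M.coverageTerm p R P τ z| ≤ ε₁ + ε₂) :=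
  theorem1_general P K p hp R (fun n => hR₀.trans_le (hR.monotone (Fin.zero_le n))) M hM τ hτ
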